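/- Let $f_1,\dots,f_M:\mathbb R^n\to\mathbb R$ be convex and $L_i$-smooth (differentiable with $L_i$-Lipschitz gradient, $L_i>0$), let $g:\mathbb R^n\to(-\infty,+\infty]$ be proper, convex and lower semicontinuous, and consider the problem $$\min_{x\in\mathbb R^n}\ \frac1M\sum_{i=1}^M f_i(x)+g(x).\tag{P}$$ Let $\gamma_i\in(0,2/L_i)$ for $i=1,\dots,M$ and put $\pi_i=\frac{1/\gamma_i}{\sum_j 1/\gamma_j}$, $\gamma=\frac{M}{\sum_j 1/\gamma_j}$, and $\mathrm{prox}_{\gamma g}(x)=\arg\min_z\{g(z)+\frac1{2\gamma}\|z-x\|^2\}$. The DAve-RPG algorithm is the following. At time $0$ the master parameter $\bar x^0\in\mathbb R^n$ is arbitrary, it is sent to all workers, and each worker's local parameter is $x_i=\bar x^0$. For $k=1,2,\dots$ the $k$-th exchange is made by a worker $i=i(k)$. Starting from its local parameter $x=x_i$, from $\Delta=0$ and from the master parameter $\bar x$ that it received at its previous exchange (at time $0$ if there was none), this worker performs $p(k)\ge1$ repetitions of $$z\leftarrow\mathrm{prox}_{\gamma g}(\bar x+\Delta),\quad x^+\leftarrow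 z-\gamma_i\nabla f_i(z),\quad \Delta\leftarrow\Delta+\pi_i(x^+-x),\quad x\leftarrow x^+;$$ it stores $x$ as its new local parameter, the master sets $\bar x^k=\bar x^{k-1}+\Delta$ and sends $\bar x^k$ to worker $i$. The iterates are $x^k=\mathrm{prox}_{\gamma g}(\bar x^k)$. The sequences $i(k)$ and $p(k)\geq 1$ are arbitrary, except that every worker makes infinitely many exchanges; in particular, delays may be unbounded. The epoch sequence is defined by $k_0=0$ and by letting $k_{m+1}$ be the smallest $k$ such that every worker made at least two updates on the time interval $[k_m,k]$, where the initialization at time $0$ counts as one update of each worker. Then: 1. If (P) has a unique minimizer $x^\star$, then $x^k\to x^\star$. 2. If (P) has at least one minimizer (possibly several), then $(x^k)$ converges to a minimizer of (P), under two additional assumptions: (i) the differences $k_{m+1}-k_m$ are uniformly bounded; (ii) the numbers of repetitions $p(k)$ are uniformly bounded. -/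

import Mathlib

open Set Filter Topology

noncomputable section

namespace DaveRPG

/-- A real-valued function on `ℝⁿ` is `L`-smooth: it is differentiable with `L`-Lipschitz gradient. -/
def IsLSmooth {n : ℕ} (L : ℝ) (f : EuclideanSpace ℝ (Fin n) → ℝ) : Prop :=
  Differentiable ℝ f ∧ ∀ x y, ‖gradient f x - gradient f y‖ ≤ L * ‖x - y‖

/-- Convexity of an extended-real-valued function. -/
def IsConvex {n : ℕ} (g : EuclideanSpace ℝ (Fin n) → EReal) : Prop :=
  ∀ x y, ∀ a b : ℝ, 0 < a → 0 < b → a + b = 1 →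
    g (a • x + b • y) ≤ (a : EReal) * g x + (b : EReal) * g y

/-- Properness: `g` takes values in `(-∞, +∞]` and is finite somewhere. -/
def IsProper {n : ℕ} (g : EuclideanSpace ℝ (Fin n) → EReal) : Prop :=
  (∀ x, g x ≠ ⊥) ∧ ∃ x, g x ≠ ⊤

/-- The objective `x ↦ (1/M) ∑ᵢ fᵢ(x) + g(x)`. -/
def objective {n M : ℕ} (f : Fin M → EuclideanSpace ℝ (Fin n) → ℝ)
    (g : EuclideanSpace ℝ (Fin n) → EReal) (x : EuclideanSpace ℝ (Fin n)) : EReal :=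
  ((1 / (M : ℝ) * ∑ i, f i x : ℝ) : EReal) + g x

/-- `x` is a (global) minimizer of the problem `min (1/M) ∑ᵢ fᵢ + g`. -/
def IsMinimizer {n M : ℕ} (f : Fin M → EuclideanSpace ℝ (Fin n) → ℝ)
    (g : EuclideanSpace ℝ (Fin n) → EReal) (x : EuclideanSpace ℝ (Fin n)) : Prop :=
  IsMinOn (objective f g) univ x

/-- The proximity operator `prox_{γ g}(x) = argmin_z { g(z) + ‖z - x‖² / (2γ) }`.
For `γ > 0` and `g` proper, convex and lsc the minimizer exists and is unique. -/
def prox {n : ℕ} (γ : ℝ) (g : EuclideanSpace ℝ (Fin n) → EReal)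
    (x : EuclideanSpace ℝ (Fin n)) : EuclideanSpace ℝ (Fin n) :=
  Classical.epsilon fun z =>
    IsMinOn (fun w => g w + ((1 / (2 * γ) * ‖w - x‖ ^ 2 : ℝ) : EReal)) univ z

/-- The weight `πᵢ = (1/γᵢ) / ∑ⱼ 1/γⱼ` of worker `i`. -/
def weight {M : ℕ} (γ : Fin M → ℝ) (i : Fin M) : ℝ :=
  (1 / γ i) / ∑ j, 1 / γ j

/-- The master stepsize `γ = M / ∑ᵢ 1/γᵢ`. -/
def masterStep {M : ℕ} (γ : Fin M → ℝ) : ℝ :=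
  (M : ℝ) / ∑ j, 1 / γ j

/-- One local repetition at worker `i`, which last received the master parameter `xbar`; the pair
`s = (Δ, x)` holds the current adjustment and the current local parameter:
`z ← prox_{γ g}(xbar + Δ)`, `x⁺ ← z - γᵢ ∇fᵢ(z)`, `Δ ← Δ + πᵢ (x⁺ - x)`, `x ← x⁺`. -/
def localStep {n M : ℕ} (f : Fin M → EuclideanSpace ℝ (Fin n) → ℝ)
    (g : EuclideanSpace ℝ (Fin n) → EReal) (γ : Fin M → ℝ) (i : Fin M)
    (xbar : EuclideanSpace ℝ (Fin n))
    (s : EuclideanSpace ℝ (Fin n) × EuclideanSpace ℝ (Fin n)) :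
    EuclideanSpace ℝ (Fin n) × EuclideanSpace ℝ (Fin n) :=
  let z := prox (masterStep γ) g (xbar + s.1)
  let xnew := z - γ i • gradient (f i) z
  (s.1 + weight γ i • (xnew - s.2), xnew)

/-- The state of the system of one master and `M` workers. -/
structure State (n M : ℕ) where
  /-- the master parameter -/
  master : EuclideanSpace ℝ (Fin n)
  /-- the local parameter of each worker, as of its last exchange with the master -/
  loc : Fin M → EuclideanSpace ℝ (Fin n)
  /-- the master parameter that each worker received at its last exchange -/
  received : Fin M → EuclideanSpace ℝ (Fin n)

/-- An exchange between worker `i` and the master: worker `i` has performed `p` local repetitions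
from the master parameter it received last; it sends its adjustment `Δ`, the master adds `Δ` to its
parameter and sends the result back to worker `i`. -/
def exchange {n M : ℕ} (f : Fin M → EuclideanSpace ℝ (Fin n) → ℝ)
    (g : EuclideanSpace ℝ (Fin n) → EReal) (γ : Fin M → ℝ) (i : Fin M) (p : ℕ)
    (S : State n M) : State n M :=
  let r := (localStep f g γ i (S.received i))^[p] (0, S.loc i)
  { master := S.master + r.1
    loc := Function.update S.loc i r.2
    received := Function.update S.received i (S.master + r.1) }

/-- The DAve-RPG algorithm. The `k`-th exchange (`k ≥ 1`) is made by worker `agent k`, after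
`reps k` local repetitions; time `0` is the initialization, with all variables equal to `x0`
(so the values `agent 0` and `reps 0` play no role). -/
def run {n M : ℕ} (f : Fin M → EuclideanSpace ℝ (Fin n) → ℝ)
    (g : EuclideanSpace ℝ (Fin n) → EReal) (γ : Fin M → ℝ) (agent : ℕ → Fin M) (reps : ℕ → ℕ)
    (x0 : EuclideanSpace ℝ (Fin n)) : ℕ → State n M
  | 0 => { master := x0, loc := fun _ => x0, received := fun _ => x0 }
  | k + 1 => exchange f g γ (agent (k + 1)) (reps (k + 1)) (run f g γ agent reps x0 k)

/-- The iterates `xᵏ = prox_{γ g}(x̄ᵏ)`, where `x̄ᵏ` is the master parameter at time `k`. -/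
def iterate {n M : ℕ} (f : Fin M → EuclideanSpace ℝ (Fin n) → ℝ)
    (g : EuclideanSpace ℝ (Fin n) → EReal) (γ : Fin M → ℝ) (agent : ℕ → Fin M) (reps : ℕ → ℕ)
    (x0 : EuclideanSpace ℝ (Fin n)) (k : ℕ) : EuclideanSpace ℝ (Fin n) :=
  prox (masterStep γ) g (run f g γ agent reps x0 k).master

/-- The number of updates of worker `i` on the time interval `[a, b]`; the initialization at
time `0` counts as an update of every worker. -/
def numUpdates {M : ℕ} (agent : ℕ → Fin M) (i : Fin M) (a b : ℕ) : ℕ :=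
  ((Finset.Icc a b).filter fun t => t = 0 ∨ agent t = i).card

/-- The epoch sequence: `k₀ = 0` and `k_{m+1}` is the smallest `k` such that every worker made at
least two updates on `[k_m, k]`. -/
def epoch {M : ℕ} (agent : ℕ → Fin M) : ℕ → ℕ
  | 0 => 0
  | m + 1 => sInf {k | ∀ i, 2 ≤ numUpdates agent i (epoch agent m) k}

end DaveRPG

end

namespace DaveRPG

/-! ### Convex functions with Lipschitz gradient. -/

section Smooth

variable {E : Type*} [NormedAddCommGroup E] [InnerProductSpace ℝ E] [CompleteSpace E]

/-! The master parameter is always the weighted mean of the local parameters. A repetition at worker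
`i` is therefore `stepMap` (weighted mean, prox, gradient step) applied to an old snapshot of all
local parameters whose coordinate `i` is current. For a minimizer `x` the vector `localPoint x` is
fixed by these maps. Each ingredient is nonexpansive towards it with a quantitative gain: the
variance identity for the mean, firm nonexpansiveness for the prox, Baillon–Haddad for the gradient
step (`norm_stepMap_sub_sq_le`). So the largest distance to `localPoint x` over the snapshots in use
(`envelope`) never increases, whatever the delays, and has a limit `C`.

Suppose `C > 0`. Some late update has distance at least `C` although its inputs have distance barely
above `C`, so all gains nearly vanish (`rigidity`): the inputs are nearly `localPoint x` shifted by
one vector `v`, and the shift nearly commutes with the prox and preserves `∇fᵢ`. The inputs from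
other workers are themselves late updates, so a second use of rigidity covers every `i`
(`exists_almostInvariant`). By compactness a limit `v` with `‖v‖ ≥ C` makes `x + v` a minimizer,
which contradicts uniqueness. Only last repetitions in two generations of updates are used, so no
bound on delays or repetitions is needed.

With several minimizers, rigidity is propagated back through whole exchanges and time windows. Each
step back costs tolerance, hence the boundedness assumptions. All snapshots in use at some time are
then close to `localPoint (x + v)`, so the monotone envelope of this new minimizer gets arbitrarily
small and tends to zero. -/

theorem hasDerivAt_comp_line {φ : E → ℝ} {G x d : E} {t : ℝ}
    (h : HasGradientAt φ G (x + t • d)) :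
    HasDerivAt (fun s : ℝ => φ (x + s • d)) (inner ℝ G d) t := by
  have h1 : HasDerivAt (fun s : ℝ => x + s • d) d t := by
    simpa using ((hasDerivAt_id t).smul_const d).const_add x
  have h2 := h.hasFDerivAt.comp_hasDerivAt t h1
  simpa [Function.comp_def] using h2

/-- The first-order condition of convexity. -/
theorem convexOn_gradient_le {φ : E → ℝ} (hφ : ConvexOn ℝ univ φ) {G x : E}
    (h : HasGradientAt φ G x) (y : E) : φ x + inner ℝ G (y - x) ≤ φ y := by
  have hc : ConvexOn ℝ univ (fun s : ℝ => φ (x + s • (y - x))) := by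
    have := hφ.comp_affineMap (AffineMap.lineMap x y : ℝ →ᵃ[ℝ] E)
    refine this.congr ?_ |>.subset (by simp) convex_univ
    intro s _
    simp [AffineMap.lineMap_apply, add_comm]
  have hd : HasDerivAt (fun s : ℝ => φ (x + s • (y - x))) (inner ℝ G (y - x)) 0 :=
    hasDerivAt_comp_line (by simpa using h)
  have := hc.le_slope_of_hasDerivAt (mem_univ 0) (mem_univ 1) zero_lt_one hd
  simp [slope_def_field] at this
  linarith

/-- The descent lemma for functions with Lipschitz gradient. -/
theorem descent_lemma {φ : E → ℝ} {G : E → E} {L : ℝ} (hG : ∀ x, HasGradientAt φ (G x) x)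
    (hL : ∀ x y, ‖G x - G y‖ ≤ L * ‖x - y‖) (x y : E) :
    φ y ≤ φ x + inner ℝ (G x) (y - x) + L / 2 * ‖y - x‖ ^ 2 := by
  set d := y - x with hd
  -- `u 1 ≤ u 0` is the claim; the Lipschitz bound makes the derivative of `u` nonpositive on `(0,
  -- 1)`.
  let u : ℝ → ℝ := fun t => φ (x + t • d) - t * inner ℝ (G x) d - t ^ 2 * (L / 2 * ‖d‖ ^ 2)
  have hu : ∀ t, HasDerivAt u
      (inner ℝ (G (x + t • d)) d - inner ℝ (G x) d - (2 * t) * (L / 2 * ‖d‖ ^ 2)) t := by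
    intro t
    have h1 := hasDerivAt_comp_line (hG (x + t • d))
    have h2 : HasDerivAt (fun s : ℝ => s * inner ℝ (G x) d) (inner ℝ (G x) d) t := by
      simpa using (hasDerivAt_id t).mul_const (inner ℝ (G x) d)
    have h3 : HasDerivAt (fun s : ℝ => s ^ 2 * (L / 2 * ‖d‖ ^ 2))
        ((2 * t) * (L / 2 * ‖d‖ ^ 2)) t := by
      simpa using (hasDerivAt_pow 2 t).mul_const (L / 2 * ‖d‖ ^ 2)
    exact (h1.sub h2).sub h3
  have hanti : AntitoneOn u (Icc 0 1) := by
    refine antitoneOn_of_deriv_nonpos (convex_Icc 0 1)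
      (fun t _ => (hu t).continuousAt.continuousWithinAt)
      (fun t _ => (hu t).differentiableAt.differentiableWithinAt) ?_
    intro t ht
    rw [interior_Icc] at ht
    rw [(hu t).deriv]
    have h1 : inner ℝ (G (x + t • d) - G x) d ≤ ‖G (x + t • d) - G x‖ * ‖d‖ :=
      real_inner_le_norm _ _
    have h2 := hL (x + t • d) x
    rw [add_sub_cancel_left, norm_smul, Real.norm_of_nonneg ht.1.le] at h2
    rw [inner_sub_left] at h1
    nlinarith [mul_le_mul_of_nonneg_right h2 (norm_nonneg d)]
  have := hanti (left_mem_Icc.2 zero_le_one) (right_mem_Icc.2 zero_le_one) zero_le_one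
  simp only [u, zero_smul, one_smul, add_zero] at this
  have hxy : x + d = y := by simp [hd]
  rw [hxy] at this
  linarith

/-- The Baillon–Haddad theorem: a Lipschitz gradient of a convex function is cocoercive. -/
theorem cocoercive_gradient {φ : E → ℝ} (hφ : ConvexOn ℝ univ φ) {G : E → E} {L : ℝ}
    (hL0 : 0 < L) (hG : ∀ x, HasGradientAt φ (G x) x)
    (hL : ∀ x y, ‖G x - G y‖ ≤ L * ‖x - y‖) (x y : E) :
    1 / L * ‖G x - G y‖ ^ 2 ≤ inner ℝ (G x - G y) (x - y) := by
  have key : ∀ x y, φ x + inner ℝ (G x) (y - x) + 1 / (2 * L) * ‖G y - G x‖ ^ 2 ≤ φ y := by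
    intro x y
    set e := G y - G x with he
    -- The point `y - e / L` minimizes the quadratic upper bound at `y` minus the affine minorant at
    -- `x`; comparing the two there leaves `‖e‖² / (2L)`.
    have h1 := convexOn_gradient_le hφ (hG x) (y - (1 / L) • e)
    have h2 := descent_lemma hG hL y (y - (1 / L) • e)
    have h3 : y - (1 / L) • e - y = -((1 / L) • e) := by abel
    have h4 : y - (1 / L) • e - x = (y - x) - (1 / L) • e := by abel
    rw [h3, norm_neg, norm_smul, inner_neg_right, inner_smul_right,
      Real.norm_of_nonneg (by positivity)] at h2
    rw [h4, inner_sub_right, inner_smul_right] at h1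
    have h5 : inner ℝ (G y) e - inner ℝ (G x) e = ‖e‖ ^ 2 := by
      rw [← inner_sub_left, ← he, real_inner_self_eq_norm_sq]
    have h6 : L / 2 * (1 / L * ‖e‖) ^ 2 = 1 / (2 * L) * ‖e‖ ^ 2 := by field_simp
    have h7 : 1 / L * inner ℝ (G y) e = 1 / L * inner ℝ (G x) e + 2 * (1 / (2 * L) * ‖e‖ ^ 2) := by
      rw [← sub_eq_iff_eq_add', ← mul_sub, h5]; field_simp
    linarith
  have h1 := key x y
  have h2 := key y x
  have h3 : inner ℝ (G x) (y - x) = - inner ℝ (G x) (x - y) := by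
    rw [← inner_neg_right, neg_sub]
  rw [norm_sub_rev] at h1
  rw [inner_sub_left]
  have h4 : 1 / L * ‖G x - G y‖ ^ 2 = 2 * (1 / (2 * L) * ‖G x - G y‖ ^ 2) := by field_simp
  linarith

/-- A gradient step with stepsize `c` is nonexpansive, with a quantitative gain. -/
theorem norm_gradient_step_sub_sq_le {φ : E → ℝ} (hφ : ConvexOn ℝ univ φ) {G : E → E} {L : ℝ}
    (hL0 : 0 < L) (hG : ∀ x, HasGradientAt φ (G x) x)
    (hL : ∀ x y, ‖G x - G y‖ ≤ L * ‖x - y‖) {c : ℝ} (hc : 0 < c) (x y : E) :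
    ‖(x - c • G x) - (y - c • G y)‖ ^ 2 ≤
      ‖x - y‖ ^ 2 - c * (2 / L - c) * ‖G x - G y‖ ^ 2 := by
  have h := cocoercive_gradient hφ hL0 hG hL x y
  have h1 : (x - c • G x) - (y - c • G y) = (x - y) - c • (G x - G y) := by
    rw [smul_sub]; abel
  rw [h1, norm_sub_sq_real, inner_smul_right, norm_smul, Real.norm_of_nonneg hc.le,
    real_inner_comm]
  have h2 := mul_le_mul_of_nonneg_left h hc.le
  have h3 : c * (2 / L - c) * ‖G x - G y‖ ^ 2 =
    2 * (c * (1 / L * ‖G x - G y‖ ^ 2)) - (c * ‖G x - G y‖) ^ 2 := by ring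
  linarith

end Smooth

/-! ### Subgradients and the proximity operator. -/

section Prox

variable {n : ℕ} {g : EuclideanSpace ℝ (Fin n) → EReal}

/-- `s` is a subgradient of the extended-real-valued function `g` at `p`. -/
def IsSubgradientAt (g : EuclideanSpace ℝ (Fin n) → EReal) (s p : EuclideanSpace ℝ (Fin n)) :
    Prop :=
  g p ≠ ⊤ ∧ ∀ w, g w ≠ ⊤ → (g p).toReal + inner ℝ s (w - p) ≤ (g w).toReal

theorem IsConvex.toReal_le (hp : IsProper g) (hc : IsConvex g) {x y : EuclideanSpace ℝ (Fin n)}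
    (hx : g x ≠ ⊤) (hy : g y ≠ ⊤) {a b : ℝ} (ha : 0 < a) (hb : 0 < b) (hab : a + b = 1) :
    g (a • x + b • y) ≠ ⊤ ∧
      (g (a • x + b • y)).toReal ≤ a * (g x).toReal + b * (g y).toReal := by
  have h := hc x y a b ha hb hab
  rw [← EReal.coe_toReal hx (hp.1 x), ← EReal.coe_toReal hy (hp.1 y), ← EReal.coe_mul,
    ← EReal.coe_mul, ← EReal.coe_add] at h
  have h1 : g (a • x + b • y) ≠ ⊤ := ne_top_of_le_ne_top (EReal.coe_ne_top _) h
  refine ⟨h1, ?_⟩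
  rwa [← EReal.coe_toReal h1 (hp.1 _), EReal.coe_le_coe_iff] at h

/-- Fermat's rule for the sum of a differentiable convex function and `g`. -/
theorem isMinOn_add_iff (hp : IsProper g) (hc : IsConvex g) {φ : EuclideanSpace ℝ (Fin n) → ℝ}
    (hφ : ConvexOn ℝ univ φ) {G p : EuclideanSpace ℝ (Fin n)} (hG : HasGradientAt φ G p) :
    IsMinOn (fun w => g w + (φ w : EReal)) univ p ↔ IsSubgradientAt g (-G) p := by
  have hcoe : ∀ {w}, g w ≠ ⊤ → g w + (φ w : EReal) = (((g w).toReal + φ w : ℝ) : EReal) := by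
    intro w hw
    rw [EReal.coe_add, EReal.coe_toReal hw (hp.1 w)]
  rw [isMinOn_iff]
  constructor
  · intro h
    have hpt : g p ≠ ⊤ := by
      obtain ⟨w, hw⟩ := hp.2
      intro hpt
      have := h w (mem_univ w)
      rw [hcoe hw, hpt, EReal.top_add_coe] at this
      exact EReal.coe_ne_top _ (top_le_iff.1 this)
    refine ⟨hpt, fun w hw => ?_⟩
    have hd : HasDerivAt (fun s : ℝ => φ (p + s • (w - p))) (inner ℝ G (w - p)) 0 :=
      hasDerivAt_comp_line (by simpa using hG)
    have hlim := hd.tendsto_slope_zero_right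
    -- Minimality at `p`, tested at `p + t (w - p)`, and convexity of `g` bound the difference
    -- quotient of `φ` from below for every `t` in `(0, 1)`.
    have hge : (g p).toReal - (g w).toReal ≤ inner ℝ G (w - p) := by
      refine ge_of_tendsto hlim ?_
      filter_upwards [Ioo_mem_nhdsGT (zero_lt_one (α := ℝ))] with t ht
      have hcv := hc.toReal_le hp hpt hw (sub_pos.2 ht.2) ht.1 (by ring)
      have heq : (1 - t) • p + t • w = p + t • (w - p) := by
        rw [sub_smul, one_smul, smul_sub]; abel
      rw [heq] at hcv
      have := h (p + t • (w - p)) (mem_univ _)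
      rw [hcoe hpt, hcoe hcv.1, EReal.coe_le_coe_iff] at this
      simp only [zero_add, zero_smul, add_zero, smul_eq_mul]
      rw [inv_mul_eq_div, le_div_iff₀ ht.1]
      linarith [hcv.2]
    rw [inner_neg_left]
    linarith
  · rintro ⟨hpt, h⟩ w -
    by_cases hw : g w = ⊤
    · rw [hw, EReal.top_add_coe]; exact le_top
    · rw [hcoe hpt, hcoe hw, EReal.coe_le_coe_iff]
      have h1 := h w hw
      have h2 := convexOn_gradient_le hφ hG w
      rw [inner_neg_left] at h1
      linarith

/-- Monotonicity of the subdifferential. -/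
theorem IsSubgradientAt.inner_nonneg {s t p q : EuclideanSpace ℝ (Fin n)}
    (hs : IsSubgradientAt g s p) (ht : IsSubgradientAt g t q) :
    0 ≤ inner ℝ (s - t) (p - q) := by
  have h1 := hs.2 q ht.1
  have h2 := ht.2 p hs.1
  rw [← neg_sub p q, inner_neg_right] at h1
  rw [inner_sub_left]
  linarith

/-- A proper convex lower semicontinuous function is bounded below by `-a - b‖x - w₀‖`. -/
theorem exists_linear_lower_bound (hp : IsProper g) (hc : IsConvex g)
    (hl : LowerSemicontinuous g) (w₀ : EuclideanSpace ℝ (Fin n)) (hw₀ : g w₀ ≠ ⊤) :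
    ∃ a : ℝ, 0 ≤ a ∧ ∀ w, g w ≠ ⊤ → (g w₀).toReal - a * (1 + ‖w - w₀‖) ≤ (g w).toReal := by
  obtain ⟨u, -, hu⟩ := LowerSemicontinuousOn.exists_isMinOn
    (Metric.nonempty_closedBall.2 zero_le_one)
    (isCompact_closedBall w₀ 1) (hl.lowerSemicontinuousOn _)
  have hu' : ∀ w, ‖w - w₀‖ ≤ 1 → g u ≤ g w := fun w hw =>
    hu (by rwa [mem_closedBall_iff_norm])
  have hut : g u ≠ ⊤ := ne_top_of_le_ne_top hw₀ (hu' w₀ (by simp))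
  have hur : ∀ w, ‖w - w₀‖ ≤ 1 → g w ≠ ⊤ → (g u).toReal ≤ (g w).toReal := fun w hw hwt =>
    EReal.toReal_le_toReal (hu' w hw) (hp.1 u) hwt
  have h0 := hur w₀ (by simp) hw₀
  refine ⟨(g w₀).toReal - (g u).toReal, by linarith, fun w hw => ?_⟩
  rcases le_or_gt ‖w - w₀‖ 1 with h1 | h1
  · have := hur w h1 hw
    nlinarith [norm_nonneg (w - w₀)]
  · set r := ‖w - w₀‖ with hr
    have hr0 : 0 < r := by linarith
    -- The point of the segment at distance 1 from `w₀` lies in the ball where `g u` is the minimum;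
    -- convexity carries this bound out to `w`.
    have hcv := hc.toReal_le hp hw₀ hw (a := 1 - 1 / r) (b := 1 / r)
      (by rw [sub_pos, div_lt_one hr0]; exact h1) (by positivity) (by ring)
    have heq : (1 - 1 / r) • w₀ + (1 / r) • w - w₀ = (1 / r) • (w - w₀) := by
      rw [sub_smul, one_smul, smul_sub]; abel
    have h2 := hur _ (by
      rw [heq, norm_smul, Real.norm_of_nonneg (by positivity), ← hr]; field_simp; rfl) hcv.1
    have h3 := h2.trans hcv.2
    have h4 := mul_le_mul_of_nonneg_left h3 hr0.le
    have h5 : r * ((1 - 1 / r) * (g w₀).toReal + 1 / r * (g w).toReal) =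
      (r - 1) * (g w₀).toReal + (g w).toReal := by field_simp
    rw [h5] at h4
    nlinarith

theorem convexOn_prox_penalty {γ : ℝ} (hγ : 0 < γ) (x : EuclideanSpace ℝ (Fin n)) :
    ConvexOn ℝ univ (fun w : EuclideanSpace ℝ (Fin n) => 1 / (2 * γ) * ‖w - x‖ ^ 2) := by
  have h1 : ConvexOn ℝ univ (fun w : EuclideanSpace ℝ (Fin n) => ‖w - x‖) := by
    simpa [sub_eq_add_neg, Function.comp_def] using
      (convexOn_univ_norm (E := EuclideanSpace ℝ (Fin n))).translate_left (-x)
  have h2 := (h1.pow (fun _ _ => norm_nonneg _) 2).smul (c := 1 / (2 * γ)) (by positivity)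
  simpa using h2

theorem hasGradientAt_prox_penalty {γ : ℝ} (x p : EuclideanSpace ℝ (Fin n)) :
    HasGradientAt (fun w : EuclideanSpace ℝ (Fin n) => 1 / (2 * γ) * ‖w - x‖ ^ 2)
      ((1 / γ) • (p - x)) p := by
  rw [hasGradientAt_iff_hasFDerivAt]
  have h1 := (((hasFDerivAt_id p).sub_const x).norm_sq).const_mul (1 / (2 * γ))
  refine h1.congr_fderiv ?_
  ext w
  simp
  ring

/-- The quadratic penalty beats the linear lower bound of `g`, so a minimizer over a large ball is
global. This gives the `Classical.epsilon` in `prox` its meaning. -/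
theorem exists_isMinOn_prox {γ : ℝ} (hγ : 0 < γ) (hp : IsProper g) (hc : IsConvex g)
    (hl : LowerSemicontinuous g) (x : EuclideanSpace ℝ (Fin n)) :
    ∃ z, IsMinOn (fun w => g w + ((1 / (2 * γ) * ‖w - x‖ ^ 2 : ℝ) : EReal)) univ z := by
  obtain ⟨w₀, hw₀⟩ := hp.2
  obtain ⟨a, ha, hb⟩ := exists_linear_lower_bound hp hc hl w₀ hw₀
  set D := ‖w₀ - x‖
  set K := 1 / (2 * γ) with hK
  have hK0 : 0 < K := by positivity
  -- With the extra `a / K` in `R'`, a point at distance `N > R'` from `x` satisfies `K * N ≥ a * (2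
  -- + D) + K * D ^ 2 + a` and `N ≥ 1`, which makes it worse than `w₀`.
  set R := 1 + D + (a * (2 + D) + K * D ^ 2) / K with hR
  have hD : 0 ≤ D := norm_nonneg _
  have hRle : 1 + D ≤ R := by
    have : 0 ≤ (a * (2 + D) + K * D ^ 2) / K := by positivity
    linarith
  have hRK : a * (2 + D) + K * D ^ 2 ≤ K * R - K := by
    have : K * R = K * (1 + D) + (a * (2 + D) + K * D ^ 2) := by
      rw [hR]; field_simp
    nlinarith
  have hlsc : LowerSemicontinuous
      (fun w => g w + ((K * ‖w - x‖ ^ 2 : ℝ) : EReal)) := by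
    refine hl.add' ?_ ?_
    · exact (continuous_coe_real_ereal.comp (by fun_prop)).lowerSemicontinuous
    · intro w
      exact EReal.continuousAt_add (Or.inr (EReal.coe_ne_bot _)) (Or.inr (EReal.coe_ne_top _))
  set R' := R + a / K with hR'
  have hRR : R ≤ R' := le_add_of_nonneg_right (by positivity)
  obtain ⟨z, -, hz⟩ := LowerSemicontinuousOn.exists_isMinOn
    (⟨w₀, by rw [mem_closedBall_iff_norm]; linarith⟩ : (Metric.closedBall x R').Nonempty)
    (isCompact_closedBall x R') (hlsc.lowerSemicontinuousOn _)
  refine ⟨z, fun w _ => ?_⟩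
  by_cases hw : ‖w - x‖ ≤ R'
  · exact hz (by rwa [mem_closedBall_iff_norm])
  · have h0 : g z + ((K * ‖z - x‖ ^ 2 : ℝ) : EReal) ≤ g w₀ + ((K * ‖w₀ - x‖ ^ 2 : ℝ) : EReal) :=
      hz (by rw [mem_closedBall_iff_norm]; linarith)
    refine h0.trans ?_
    by_cases hwt : g w = ⊤
    · change _ ≤ g w + ((K * ‖w - x‖ ^ 2 : ℝ) : EReal)
      rw [hwt, EReal.top_add_coe]; exact le_top
    change g w₀ + ((K * ‖w₀ - x‖ ^ 2 : ℝ) : EReal) ≤ g w + ((K * ‖w - x‖ ^ 2 : ℝ) : EReal)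
    rw [← EReal.coe_toReal hw₀ (hp.1 w₀), ← EReal.coe_toReal hwt (hp.1 w), ← EReal.coe_add,
      ← EReal.coe_add, EReal.coe_le_coe_iff]
    have h1 := hb w hwt
    have h2 : ‖w - w₀‖ ≤ ‖w - x‖ + D := by
      have := norm_sub_le_norm_sub_add_norm_sub w x w₀
      rwa [norm_sub_rev x w₀] at this
    push Not at hw
    set N := ‖w - x‖
    have hKR' : K * R' = K * R + a := by rw [hR']; field_simp
    have h3 : a * (2 + D) + K * D ^ 2 + a ≤ K * N := by nlinarith
    have h4 : 1 ≤ N := by linarith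
    have h5 : (a * (2 + D) + K * D ^ 2 + a) * N ≤ K * N * N :=
      mul_le_mul_of_nonneg_right h3 (by linarith)
    have h6 : a * (1 + ‖w - w₀‖) ≤ a * (1 + (N + D)) := by gcongr
    have h7 : a * (1 + D) + K * D ^ 2 ≤ (a * (1 + D) + K * D ^ 2) * N :=
      le_mul_of_one_le_right (by positivity) h4
    have h8 : 0 ≤ a * N := by positivity
    nlinarith

/-- The proximal point `p = prox_{γ g}(x)` is characterized by `(x - p) / γ ∈ ∂g(p)`. -/
theorem isSubgradientAt_prox {γ : ℝ} (hγ : 0 < γ) (hp : IsProper g) (hc : IsConvex g)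
    (hl : LowerSemicontinuous g) (x : EuclideanSpace ℝ (Fin n)) :
    IsSubgradientAt g ((1 / γ) • (x - prox γ g x)) (prox γ g x) := by
  have h : IsMinOn (fun w => g w + ((1 / (2 * γ) * ‖w - x‖ ^ 2 : ℝ) : EReal)) univ
      (prox γ g x) := Classical.epsilon_spec (exists_isMinOn_prox hγ hp hc hl x)
  have := (isMinOn_add_iff hp hc (convexOn_prox_penalty hγ x)
    (hasGradientAt_prox_penalty (γ := γ) x (prox γ g x))).1 h
  rwa [← smul_neg, neg_sub] at this

/-- The proximity operator is firmly nonexpansive. -/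
theorem norm_prox_sub_prox_sq_le {γ : ℝ} (hγ : 0 < γ) (hp : IsProper g) (hc : IsConvex g)
    (hl : LowerSemicontinuous g) (x y : EuclideanSpace ℝ (Fin n)) :
    ‖prox γ g x - prox γ g y‖ ^ 2 ≤
      ‖x - y‖ ^ 2 - ‖(x - y) - (prox γ g x - prox γ g y)‖ ^ 2 := by
  have h := (isSubgradientAt_prox hγ hp hc hl x).inner_nonneg
    (isSubgradientAt_prox hγ hp hc hl y)
  rw [← smul_sub, real_inner_smul_left] at h
  have h1 := nonneg_of_mul_nonneg_right h (by positivity : 0 < 1 / γ)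
  have h2 : x - prox γ g x - (y - prox γ g y) = (x - y) - (prox γ g x - prox γ g y) := by abel
  rw [h2, inner_sub_left, real_inner_self_eq_norm_sq] at h1
  rw [norm_sub_sq_real (x - y)]
  linarith

theorem norm_prox_sub_prox_le {γ : ℝ} (hγ : 0 < γ) (hp : IsProper g) (hc : IsConvex g)
    (hl : LowerSemicontinuous g) (x y : EuclideanSpace ℝ (Fin n)) :
    ‖prox γ g x - prox γ g y‖ ≤ ‖x - y‖ := by
  have := norm_prox_sub_prox_sq_le hγ hp hc hl x y
  exact (sq_le_sq₀ (norm_nonneg _) (norm_nonneg _)).1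
    (by linarith [sq_nonneg ‖(x - y) - (prox γ g x - prox γ g y)‖])

/-- Uniqueness comes from monotonicity of the subdifferential: two solutions for the same `x` give
`-‖difference‖² ≥ 0`. -/
theorem prox_eq_iff {γ : ℝ} (hγ : 0 < γ) (hp : IsProper g) (hc : IsConvex g)
    (hl : LowerSemicontinuous g) (x p : EuclideanSpace ℝ (Fin n)) :
    prox γ g x = p ↔ IsSubgradientAt g ((1 / γ) • (x - p)) p := by
  constructor
  · rintro rfl
    exact isSubgradientAt_prox hγ hp hc hl x
  · intro h
    have h1 := (isSubgradientAt_prox hγ hp hc hl x).inner_nonneg h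
    rw [← smul_sub, real_inner_smul_left] at h1
    have h2 := nonneg_of_mul_nonneg_right h1 (by positivity : 0 < 1 / γ)
    have h3 : x - prox γ g x - (x - p) = -(prox γ g x - p) := by abel
    rw [h3, inner_neg_left, real_inner_self_eq_norm_sq] at h2
    have h4 : ‖prox γ g x - p‖ = 0 := by
      have := sq_nonneg ‖prox γ g x - p‖
      exact pow_eq_zero_iff (two_ne_zero) |>.1 (by linarith)
    exact sub_eq_zero.1 (norm_eq_zero.1 h4)

end Prox

/-! ### Fixed points, nonexpansiveness and rigidity of the local step. -/

/-- The standing assumptions on the problem and on the stepsizes. -/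
structure Assumptions {n M : ℕ} (f : Fin M → EuclideanSpace ℝ (Fin n) → ℝ)
    (g : EuclideanSpace ℝ (Fin n) → EReal) (L γ : Fin M → ℝ) : Prop where
  convex_f : ∀ i, ConvexOn ℝ univ (f i)
  L_pos : ∀ i, 0 < L i
  smooth : ∀ i, IsLSmooth (L i) (f i)
  proper : IsProper g
  convex_g : IsConvex g
  lsc : LowerSemicontinuous g
  step_mem : ∀ i, γ i ∈ Ioo 0 (2 / L i)
  M_pos : 0 < M

/-- The local repetition seen as a map of the vector of all local parameters. -/
noncomputable def stepMap {n M : ℕ} (f : Fin M → EuclideanSpace ℝ (Fin n) → ℝ)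
    (g : EuclideanSpace ℝ (Fin n) → EReal) (γ : Fin M → ℝ) (i : Fin M)
    (y : Fin M → EuclideanSpace ℝ (Fin n)) : EuclideanSpace ℝ (Fin n) :=
  prox (masterStep γ) g (∑ j, weight γ j • y j) -
    γ i • gradient (f i) (prox (masterStep γ) g (∑ j, weight γ j • y j))

/-- The local parameters associated with a point `x`. -/
noncomputable def localPoint {n M : ℕ} (f : Fin M → EuclideanSpace ℝ (Fin n) → ℝ) (γ : Fin M → ℝ)
    (x : EuclideanSpace ℝ (Fin n)) (i : Fin M) : EuclideanSpace ℝ (Fin n) :=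
  x - γ i • gradient (f i) x

/-- The variance identity for a weighted mean. -/
theorem sum_weighted_norm_sub_mean_sq {E ι : Type*} [NormedAddCommGroup E] [InnerProductSpace ℝ E]
    [Fintype ι] {w : ι → ℝ} (hw : ∑ j, w j = 1) (a : ι → E) :
    ∑ j, w j * ‖a j - ∑ l, w l • a l‖ ^ 2 = ∑ j, w j * ‖a j‖ ^ 2 - ‖∑ l, w l • a l‖ ^ 2 := by
  set m := ∑ l, w l • a l with hm
  have h1 : ∑ j, w j * inner ℝ (a j) m = ‖m‖ ^ 2 := by
    rw [← real_inner_self_eq_norm_sq]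
    nth_rewrite 2 [hm]
    rw [sum_inner]
    exact Finset.sum_congr rfl fun j _ => (real_inner_smul_left _ _ _).symm
  have h2 : ∀ j, w j * ‖a j - m‖ ^ 2 =
      w j * ‖a j‖ ^ 2 - 2 * (w j * inner ℝ (a j) m) + w j * ‖m‖ ^ 2 := by
    intro j
    rw [norm_sub_sq_real]; ring
  simp_rw [h2]
  rw [Finset.sum_add_distrib, Finset.sum_sub_distrib, ← Finset.mul_sum, ← Finset.sum_mul, h1, hw]
  ring

theorem exists_pos_forall_le {ι : Type*} [Finite ι] {h : ι → ℝ} (hh : ∀ i, 0 < h i) :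
    ∃ κ, 0 < κ ∧ ∀ i, κ ≤ h i := by
  cases isEmpty_or_nonempty ι
  · exact ⟨1, one_pos, fun i => isEmptyElim i⟩
  · obtain ⟨i, hi⟩ := Finite.exists_min h
    exact ⟨h i, hh i, hi⟩

section

variable {n M : ℕ} {f : Fin M → EuclideanSpace ℝ (Fin n) → ℝ}
  {g : EuclideanSpace ℝ (Fin n) → EReal} {L γ : Fin M → ℝ}

namespace Assumptions

theorem sum_inv_pos (h : Assumptions f g L γ) : 0 < ∑ j, 1 / γ j :=
  Finset.sum_pos (fun j _ => one_div_pos.2 (h.step_mem j).1) ⟨⟨0, h.M_pos⟩, Finset.mem_univ _⟩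

theorem masterStep_pos (h : Assumptions f g L γ) : 0 < masterStep γ :=
  div_pos (Nat.cast_pos.2 h.M_pos) h.sum_inv_pos

theorem weight_pos (h : Assumptions f g L γ) (i : Fin M) : 0 < weight γ i :=
  div_pos (one_div_pos.2 (h.step_mem i).1) h.sum_inv_pos

theorem sum_weight (h : Assumptions f g L γ) : ∑ i, weight γ i = 1 := by
  simp only [weight]
  rw [← Finset.sum_div, div_self h.sum_inv_pos.ne']

theorem hasGradientAt (h : Assumptions f g L γ) (i : Fin M) (x : EuclideanSpace ℝ (Fin n)) :
    HasGradientAt (f i) (gradient (f i) x) x :=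
  ((h.smooth i).1 x).hasGradientAt

theorem weight_mul_step (h : Assumptions f g L γ) (i : Fin M) :
    weight γ i * γ i = masterStep γ * (1 / M) := by
  have h1 := (h.step_mem i).1.ne'
  have h2 : (M : ℝ) ≠ 0 := (Nat.cast_pos.2 h.M_pos).ne'
  simp only [weight, masterStep]
  field_simp

/-- All products `πᵢ γᵢ` equal `γ / M`, so steps of different sizes average to one gradient step of
size `γ` on the mean of the `fᵢ`. -/
theorem sum_weight_smul_localPoint (h : Assumptions f g L γ) (x : EuclideanSpace ℝ (Fin n)) :
    ∑ i, weight γ i • localPoint f γ x i =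
      x - masterStep γ • ((1 / (M : ℝ)) • ∑ i, gradient (f i) x) := by
  simp only [localPoint, smul_sub, smul_smul, h.weight_mul_step]
  rw [Finset.sum_sub_distrib, ← Finset.sum_smul, h.sum_weight, one_smul, Finset.smul_sum]

theorem prox_le (h : Assumptions f g L γ) (x y : EuclideanSpace ℝ (Fin n)) :
    ‖prox (masterStep γ) g x - prox (masterStep γ) g y‖ ≤ ‖x - y‖ :=
  norm_prox_sub_prox_le h.masterStep_pos h.proper h.convex_g h.lsc x y

/-- Minimizers are the fixed points of the synchronous algorithm. -/
theorem isMinimizer_iff (h : Assumptions f g L γ) (x : EuclideanSpace ℝ (Fin n)) :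
    IsMinimizer f g x ↔
      prox (masterStep γ) g (∑ i, weight γ i • localPoint f γ x i) = x := by
  have hM : (0 : ℝ) ≤ 1 / M := by positivity
  have hconv : ConvexOn ℝ univ (fun w => 1 / (M : ℝ) * ∑ i, f i w) := by
    have h1 : ConvexOn ℝ univ (∑ i, f i) :=
      Finset.sum_induction _ (fun φ => ConvexOn ℝ univ φ) (fun _ _ ha hb => ha.add hb)
        (convexOn_const 0 convex_univ) (fun i _ => h.convex_f i)
    simpa using h1.smul hM
  have hgrad : HasGradientAt (fun w => 1 / (M : ℝ) * ∑ i, f i w)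
      ((1 / (M : ℝ)) • ∑ i, gradient (f i) x) x := by
    rw [hasGradientAt_iff_hasFDerivAt]
    have h1 := (HasFDerivAt.fun_sum (u := Finset.univ)
      fun i _ => (h.hasGradientAt i x).hasFDerivAt).const_mul (1 / (M : ℝ))
    refine h1.congr_fderiv ?_
    simp
  have h1 := isMinOn_add_iff h.proper h.convex_g hconv hgrad
  have h2 : objective f g = fun w => g w + ((1 / (M : ℝ) * ∑ i, f i w : ℝ) : EReal) := by
    funext w
    rw [objective, add_comm]
  rw [IsMinimizer, h2, h1, prox_eq_iff h.masterStep_pos h.proper h.convex_g h.lsc,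
    h.sum_weight_smul_localPoint]
  have h3 : (1 / masterStep γ) • (x - masterStep γ • ((1 / (M : ℝ)) • ∑ i, gradient (f i) x) - x) =
      -((1 / (M : ℝ)) • ∑ i, gradient (f i) x) := by
    rw [sub_right_comm, sub_self, zero_sub, smul_neg, smul_smul,
      one_div_mul_cancel h.masterStep_pos.ne', one_smul]
  rw [h3]

theorem sum_weight_smul_sub (y w : Fin M → EuclideanSpace ℝ (Fin n)) :
    ∑ j, weight γ j • (y j - w j) = ∑ j, weight γ j • y j - ∑ j, weight γ j • w j := by
  simp only [smul_sub, Finset.sum_sub_distrib]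

/-- The local step is nonexpansive towards a fixed point, with a quantitative gain. -/
theorem norm_stepMap_sub_sq_le (h : Assumptions f g L γ) {x : EuclideanSpace ℝ (Fin n)}
    (hx : IsMinimizer f g x) (i : Fin M) (y : Fin M → EuclideanSpace ℝ (Fin n)) :
    ‖stepMap f g γ i y - localPoint f γ x i‖ ^ 2 +
      ∑ j, weight γ j * ‖(y j - localPoint f γ x j) -
        ∑ l, weight γ l • (y l - localPoint f γ x l)‖ ^ 2 +
      ‖∑ l, weight γ l • (y l - localPoint f γ x l) -
        (prox (masterStep γ) g (∑ j, weight γ j • y j) - x)‖ ^ 2 +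
      γ i * (2 / L i - γ i) * ‖gradient (f i) (prox (masterStep γ) g (∑ j, weight γ j • y j)) -
        gradient (f i) x‖ ^ 2 ≤
      ∑ j, weight γ j * ‖y j - localPoint f γ x j‖ ^ 2 := by
  have h1 := norm_gradient_step_sub_sq_le (h.convex_f i) (h.L_pos i) (h.hasGradientAt i)
    (h.smooth i).2 (h.step_mem i).1 (prox (masterStep γ) g (∑ j, weight γ j • y j)) x
  have h2 := norm_prox_sub_prox_sq_le h.masterStep_pos h.proper h.convex_g h.lsc
    (∑ j, weight γ j • y j) (∑ j, weight γ j • localPoint f γ x j)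
  rw [(h.isMinimizer_iff x).1 hx, ← sum_weight_smul_sub] at h2
  have h3 := sum_weighted_norm_sub_mean_sq h.sum_weight (fun j => y j - localPoint f γ x j)
  rw [h3]
  simp only [stepMap, localPoint] at *
  linarith

/-- The gains are nonnegative and a weighted mean of squares is at most the largest square. -/
theorem norm_stepMap_sub_le (h : Assumptions f g L γ) {x : EuclideanSpace ℝ (Fin n)}
    (hx : IsMinimizer f g x) (i : Fin M) {y : Fin M → EuclideanSpace ℝ (Fin n)} {r : ℝ}
    (hy : ∀ j, ‖y j - localPoint f γ x j‖ ≤ r) :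
    ‖stepMap f g γ i y - localPoint f γ x i‖ ≤ r := by
  have hr : 0 ≤ r := (norm_nonneg _).trans (hy i)
  have h1 := h.norm_stepMap_sub_sq_le hx i y
  have h2 : ∑ j, weight γ j * ‖y j - localPoint f γ x j‖ ^ 2 ≤ r ^ 2 := by
    calc ∑ j, weight γ j * ‖y j - localPoint f γ x j‖ ^ 2 ≤ ∑ j, weight γ j * r ^ 2 := by
          refine Finset.sum_le_sum fun j _ => mul_le_mul_of_nonneg_left ?_ (h.weight_pos j).le
          exact pow_le_pow_left₀ (norm_nonneg _) (hy j) 2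
      _ = r ^ 2 := by rw [← Finset.sum_mul, h.sum_weight, one_mul]
  have h3 : 0 ≤ ∑ j, weight γ j * ‖(y j - localPoint f γ x j) -
        ∑ l, weight γ l • (y l - localPoint f γ x l)‖ ^ 2 :=
    Finset.sum_nonneg fun j _ => mul_nonneg (h.weight_pos j).le (sq_nonneg _)
  have h4 : 0 ≤ γ i * (2 / L i - γ i) :=
    mul_nonneg (h.step_mem i).1.le (sub_nonneg.2 (h.step_mem i).2.le)
  refine (sq_le_sq₀ (norm_nonneg _) hr).1 ?_
  have h5 := mul_nonneg h4 (sq_nonneg ‖gradient (f i) (prox (masterStep γ) g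
    (∑ j, weight γ j • y j)) - gradient (f i) x‖)
  have h6 := sq_nonneg ‖∑ l, weight γ l • (y l - localPoint f γ x l) -
        (prox (masterStep γ) g (∑ j, weight γ j • y j) - x)‖
  linarith

/-- Rigidity: if the local step does not decrease the distance to a fixed point, then the argument
is almost a translate of the fixed point, and the translation almost leaves the step invariant. -/
theorem rigidity (h : Assumptions f g L γ) {x : EuclideanSpace ℝ (Fin n)}
    (hx : IsMinimizer f g x) {C : ℝ} (hC : 0 < C) {ε : ℝ} (hε : 0 < ε) :
    ∃ δ, 0 < δ ∧ ∀ (i : Fin M) (y : Fin M → EuclideanSpace ℝ (Fin n))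
      (v : EuclideanSpace ℝ (Fin n)), (∀ j, ‖y j - localPoint f γ x j‖ ≤ C + δ) → C ≤ ‖v‖ →
      ‖stepMap f g γ i y - localPoint f γ x i - v‖ ≤ δ →
      (∀ j, ‖y j - localPoint f γ x j - v‖ ≤ ε) ∧
      ‖prox (masterStep γ) g (∑ j, weight γ j • y j) - x - v‖ ≤ ε ∧
      ‖gradient (f i) (prox (masterStep γ) g (∑ j, weight γ j • y j)) -
        gradient (f i) x‖ ≤ ε := by
  obtain ⟨κ₁, hκ₁, hκw⟩ := exists_pos_forall_le h.weight_pos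
  obtain ⟨κ₂, hκ₂, hκc⟩ := exists_pos_forall_le (h := fun i => γ i * (2 / L i - γ i))
    (fun i => mul_pos (h.step_mem i).1 (sub_pos.2 (h.step_mem i).2))
  obtain ⟨κ₃, hκ₃, hκs⟩ := exists_pos_forall_le (h := fun i => ε / (4 * γ i))
    (fun i => div_pos hε (mul_pos four_pos (h.step_mem i).1))
  -- A lower bound for the coefficients of all three gains; the 1 is that of the prox gain. Below,
  -- `κ₃` in `η` ensures `γ i * η ≤ ε / 4`.
  set κ := min 1 (min κ₁ κ₂) with hκdef
  have hκ : 0 < κ := lt_min one_pos (lt_min hκ₁ hκ₂)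
  set η := min (ε / 4) κ₃ with hηdef
  have hη : 0 < η := lt_min (by positivity) hκ₃
  have hηε : η ≤ ε / 4 := min_le_left _ _
  -- The total gain is at most `(C + δ)² - (C - δ)² = 4Cδ`; this choice keeps it below `κ η²`, so
  -- every deviation is at most `η`.
  set δ := min (min C η) (κ * η ^ 2 / (4 * C)) with hδdef
  have hδC : δ ≤ C := (min_le_left _ _).trans (min_le_left _ _)
  have hδη : δ ≤ η := (min_le_left _ _).trans (min_le_right _ _)
  have hδκ : 4 * C * δ ≤ κ * η ^ 2 := by
    have := min_le_right (min C η) (κ * η ^ 2 / (4 * C))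
    rw [← hδdef, le_div_iff₀ (by positivity)] at this
    linarith
  refine ⟨δ, lt_min (lt_min hC hη) (by positivity), ?_⟩
  intro i y v hy hv hS
  have h1 := h.norm_stepMap_sub_sq_le hx i y
  set b := stepMap f g γ i y - localPoint f γ x i with hb
  set m := ∑ l, weight γ l • (y l - localPoint f γ x l) with hm
  set z := prox (masterStep γ) g (∑ j, weight γ j • y j) with hz
  set e := gradient (f i) z - gradient (f i) x with he
  have h2 : ∑ j, weight γ j * ‖y j - localPoint f γ x j‖ ^ 2 ≤ (C + δ) ^ 2 := by
    calc ∑ j, weight γ j * ‖y j - localPoint f γ x j‖ ^ 2 ≤ ∑ j, weight γ j * (C + δ) ^ 2 := by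
          refine Finset.sum_le_sum fun j _ => mul_le_mul_of_nonneg_left ?_ (h.weight_pos j).le
          exact pow_le_pow_left₀ (norm_nonneg _) (hy j) 2
      _ = (C + δ) ^ 2 := by rw [← Finset.sum_mul, h.sum_weight, one_mul]
  have h3 : (C - δ) ^ 2 ≤ ‖b‖ ^ 2 := by
    refine pow_le_pow_left₀ (sub_nonneg.2 hδC) ?_ 2
    have := norm_sub_norm_le v b
    rw [norm_sub_rev v b] at this
    linarith
  have hterm : ∀ j, 0 ≤ weight γ j * ‖(y j - localPoint f γ x j) - m‖ ^ 2 := fun j =>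
    mul_nonneg (h.weight_pos j).le (sq_nonneg _)
  have hci : 0 ≤ γ i * (2 / L i - γ i) * ‖e‖ ^ 2 := mul_nonneg (hκ₂.le.trans (hκc i)) (sq_nonneg _)
  have hsum := Finset.sum_nonneg fun j (_ : j ∈ Finset.univ) => hterm j
  have hgap : (C + δ) ^ 2 - (C - δ) ^ 2 = 4 * C * δ := by ring
  have hsmall : ∀ {c r : ℝ}, κ ≤ c → 0 ≤ r → c * r ^ 2 ≤ κ * η ^ 2 → r ≤ η := by
    intro c r hc hr hcr
    refine (sq_le_sq₀ hr hη.le).1 (le_of_mul_le_mul_left ?_ hκ)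
    exact (mul_le_mul_of_nonneg_right hc (sq_nonneg r)).trans hcr
  have hA : ∀ j, ‖(y j - localPoint f γ x j) - m‖ ≤ η := by
    intro j
    refine hsmall (((min_le_right _ _).trans (min_le_left _ _)).trans (hκw j)) (norm_nonneg _) ?_
    have := Finset.single_le_sum (fun j _ => hterm j) (Finset.mem_univ j)
    linarith [sq_nonneg ‖m - (z - x)‖]
  have hB : ‖m - (z - x)‖ ≤ η := by
    refine hsmall (min_le_left _ _) (norm_nonneg _) ?_
    linarith
  have hE : ‖e‖ ≤ η := by
    refine hsmall (((min_le_right _ _).trans (min_le_right _ _)).trans (hκc i)) (norm_nonneg _) ?_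
    linarith [sq_nonneg ‖m - (z - x)‖]
  have hbz : z - x - v = (b - v) + γ i • e := by
    simp only [hb, he, stepMap, localPoint, ← hz, smul_sub]; abel
  have hγe : ‖γ i • e‖ ≤ ε / 4 := by
    have hγi := (h.step_mem i).1
    rw [norm_smul, Real.norm_of_nonneg hγi.le]
    have h5 : ‖e‖ ≤ ε / (4 * γ i) := (hE.trans (min_le_right _ _)).trans (hκs i)
    rw [le_div_iff₀ (by positivity)] at h5
    linarith
  have hzv : ‖z - x - v‖ ≤ ε / 2 := by
    rw [hbz]
    have := norm_add_le (b - v) (γ i • e)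
    linarith
  refine ⟨fun j => ?_, by linarith, by linarith⟩
  have h6 : y j - localPoint f γ x j - v =
      ((y j - localPoint f γ x j) - m) + (m - (z - x)) + (z - x - v) := by abel
  rw [h6]
  have := norm_add₃_le (a := (y j - localPoint f γ x j) - m) (b := m - (z - x)) (c := z - x - v)
  linarith [hA j]

/-- A translation that leaves all local steps invariant leads to another minimizer. -/
theorem isMinimizer_add (h : Assumptions f g L γ) {x v : EuclideanSpace ℝ (Fin n)}
    (hgrad : ∀ i, gradient (f i) (x + v) = gradient (f i) x)
    (hprox : prox (masterStep γ) g (∑ i, weight γ i • localPoint f γ x i + v) = x + v) :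
    IsMinimizer f g (x + v) ∧ ∀ i, localPoint f γ (x + v) i = localPoint f γ x i + v := by
  have h1 : ∀ i, localPoint f γ (x + v) i = localPoint f γ x i + v := by
    intro i
    simp only [localPoint, hgrad i]; abel
  refine ⟨?_, h1⟩
  rw [h.isMinimizer_iff]
  simp only [h1, smul_add, Finset.sum_add_distrib, ← Finset.sum_smul, h.sum_weight, one_smul]
  exact hprox

end Assumptions

end

/-! ### Update times, epochs and delays. -/

/-- The time of the last update of each worker up to time `k`. -/
def lastUpdate {M : ℕ} (agent : ℕ → Fin M) : ℕ → Fin M → ℕ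
  | 0 => fun _ => 0
  | k + 1 => Function.update (lastUpdate agent k) (agent (k + 1)) (k + 1)

section LastUpdate

variable {M : ℕ} {agent : ℕ → Fin M}

theorem lastUpdate_succ_self (k : ℕ) : lastUpdate agent (k + 1) (agent (k + 1)) = k + 1 := by
  simp [lastUpdate]

theorem lastUpdate_succ_of_ne {k : ℕ} {j : Fin M} (h : j ≠ agent (k + 1)) :
    lastUpdate agent (k + 1) j = lastUpdate agent k j := by
  simp [lastUpdate, h]

theorem lastUpdate_le (k : ℕ) (j : Fin M) : lastUpdate agent k j ≤ k := by
  induction k with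
  | zero => simp [lastUpdate]
  | succ k ih =>
    by_cases h : j = agent (k + 1)
    · rw [h, lastUpdate_succ_self]
    · rw [lastUpdate_succ_of_ne h]; omega

theorem agent_lastUpdate {k : ℕ} {j : Fin M} (h : lastUpdate agent k j ≠ 0) :
    agent (lastUpdate agent k j) = j := by
  induction k with
  | zero => simp [lastUpdate] at h
  | succ k ih =>
    by_cases hj : j = agent (k + 1)
    · rw [hj, lastUpdate_succ_self]
    · rw [lastUpdate_succ_of_ne hj] at h ⊢
      exact ih h

theorem le_lastUpdate {k t : ℕ} {j : Fin M} (htk : t ≤ k) (ht : t = 0 ∨ agent t = j) :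
    t ≤ lastUpdate agent k j := by
  induction k with
  | zero => omega
  | succ k ih =>
    by_cases hj : j = agent (k + 1)
    · rw [hj, lastUpdate_succ_self]; exact htk
    · rw [lastUpdate_succ_of_ne hj]
      refine ih (Nat.lt_succ_iff.1 (lt_of_le_of_ne htk ?_))
      rintro rfl
      rcases ht with h | h
      · omega
      · exact hj h.symm

theorem exists_forall_le_lastUpdate (hagent : ∀ i, ∀ N : ℕ, ∃ k, N ≤ k ∧ agent k = i) (T : ℕ) :
    ∃ K, ∀ k, K ≤ k → ∀ j, T ≤ lastUpdate agent k j := by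
  choose t ht using fun j => hagent j T
  refine ⟨Finset.univ.sup t, fun k hk j => (ht j).1.trans (le_lastUpdate ?_ (Or.inr (ht j).2))⟩
  exact (Finset.le_sup (Finset.mem_univ j)).trans hk

/-- Every epoch contains at least two updates of each worker. -/
theorem two_le_numUpdates_epoch (hagent : ∀ i, ∀ N : ℕ, ∃ k, N ≤ k ∧ agent k = i) (m : ℕ)
    (i : Fin M) : 2 ≤ numUpdates agent i (epoch agent m) (epoch agent (m + 1)) := by
  -- Nonemptiness is essential, as `sInf ∅ = 0` in `ℕ`.
  have hne : {k | ∀ i, 2 ≤ numUpdates agent i (epoch agent m) k}.Nonempty := by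
    choose t ht using fun i => hagent i (epoch agent m)
    choose u hu using fun i => hagent i (t i + 1)
    refine ⟨Finset.univ.sup u, fun i => ?_⟩
    have hle : u i ≤ Finset.univ.sup u := Finset.le_sup (Finset.mem_univ i)
    have h1 := (ht i).1
    have h2 := (hu i).1
    refine (Finset.card_pair (show t i ≠ u i by omega)).symm.le.trans (Finset.card_le_card ?_)
    intro s hs
    rw [Finset.mem_insert, Finset.mem_singleton] at hs
    rw [Finset.mem_filter, Finset.mem_Icc]
    rcases hs with rfl | rfl
    · exact ⟨⟨h1, by omega⟩, Or.inr (ht i).2⟩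
    · exact ⟨⟨by omega, hle⟩, Or.inr (hu i).2⟩
  exact Nat.sInf_mem hne i

/-- Bounded epochs lead to bounded delays. -/
theorem exists_le_lastUpdate_add (hagent : ∀ i, ∀ N : ℕ, ∃ k, N ≤ k ∧ agent k = i) {B : ℕ}
    (hB : ∀ m, epoch agent (m + 1) ≤ epoch agent m + B) (d : ℕ) (i : Fin M) :
    d ≤ lastUpdate agent d i + 2 * B := by
  have hupd : ∀ m, ∃ t, epoch agent m ≤ t ∧ t ≤ epoch agent (m + 1) ∧ (t = 0 ∨ agent t = i) := by
    intro m
    have h := two_le_numUpdates_epoch hagent m i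
    obtain ⟨t, ht⟩ := Finset.card_pos.1 (lt_of_lt_of_le two_pos h)
    rw [Finset.mem_filter, Finset.mem_Icc] at ht
    exact ⟨t, ht.1.1, ht.1.2, ht.2⟩
  -- Two updates need two distinct times in the interval.
  have hlt : StrictMono (epoch agent) := by
    refine strictMono_nat_of_lt_succ fun m => ?_
    by_contra hcon
    have h := two_le_numUpdates_epoch hagent m i
    have h1 : numUpdates agent i (epoch agent m) (epoch agent (m + 1)) ≤
        (Finset.Icc (epoch agent m) (epoch agent (m + 1))).card := Finset.card_filter_le _ _
    rw [Nat.card_Icc] at h1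
    omega
  have hex : ∃ m, d < epoch agent (m + 1) :=
    ⟨d, lt_of_lt_of_le (Nat.lt_succ_self d) (hlt.id_le (d + 1))⟩
  classical
  obtain ⟨m, hm, hmin⟩ : ∃ m, d < epoch agent (m + 1) ∧ ∀ l < m, ¬ d < epoch agent (l + 1) :=
    ⟨Nat.find hex, Nat.find_spec hex, fun l hl => Nat.find_min hex hl⟩
  cases m with
  | zero =>
    have := hB 0
    have h0 : epoch agent 0 = 0 := rfl
    omega
  | succ m =>
    -- The time `d` lies in one epoch and the previous epoch contains an update of `i`, which
    -- explains the `2 * B`.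
    have h1 := hmin m (Nat.lt_succ_self m)
    obtain ⟨t, ht1, ht2, ht⟩ := hupd m
    have h2 := le_lastUpdate (k := d) (by omega) ht
    have := hB m
    have := hB (m + 1)
    omega

end LastUpdate

/-! ### Reduction of the algorithm to an asynchronous iteration of the local parameters. -/

section Run

variable {n M : ℕ} (f : Fin M → EuclideanSpace ℝ (Fin n) → ℝ)
  (g : EuclideanSpace ℝ (Fin n) → EReal) (γ : Fin M → ℝ) (agent : ℕ → Fin M) (reps : ℕ → ℕ)

/-- The asynchronous iteration satisfied by the local parameters. -/
structure IsAsyncRun (X : ℕ → Fin M → EuclideanSpace ℝ (Fin n)) : Prop where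
  succ_of_ne : ∀ k j, j ≠ agent (k + 1) → X (k + 1) j = X k j
  succ_self : ∀ k, X (k + 1) (agent (k + 1)) =
    (fun u => stepMap f g γ (agent (k + 1)) (Function.update
      (X (lastUpdate agent k (agent (k + 1)))) (agent (k + 1)) u))^[reps (k + 1)]
      (X k (agent (k + 1)))

variable {f g γ agent reps}

/-- A worker's own coordinate in its snapshot is never outdated: the diagonal of the snapshots
carries the current values. -/
theorem IsAsyncRun.apply_lastUpdate {X : ℕ → Fin M → EuclideanSpace ℝ (Fin n)}
    (hX : IsAsyncRun f g γ agent reps X) (k : ℕ) (j : Fin M) :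
    X (lastUpdate agent k j) j = X k j := by
  induction k with
  | zero => rfl
  | succ k ih =>
    by_cases h : j = agent (k + 1)
    · subst h; rw [lastUpdate_succ_self]
    · rw [lastUpdate_succ_of_ne h, ih, hX.succ_of_ne k j h]

variable (x0 : EuclideanSpace ℝ (Fin n))

theorem run_succ_loc_of_ne {k : ℕ} {j : Fin M} (h : j ≠ agent (k + 1)) :
    (run f g γ agent reps x0 (k + 1)).loc j = (run f g γ agent reps x0 k).loc j := by
  simp [run, exchange, h]

theorem run_received (k : ℕ) (j : Fin M) :
    (run f g γ agent reps x0 k).received j =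
      (run f g γ agent reps x0 (lastUpdate agent k j)).master := by
  induction k with
  | zero => rfl
  | succ k ih =>
    by_cases h : j = agent (k + 1)
    · subst h
      rw [lastUpdate_succ_self]
      simp [run, exchange]
    · rw [lastUpdate_succ_of_ne h, ← ih]
      simp [run, exchange, h]

theorem run_loc_lastUpdate (k : ℕ) (j : Fin M) :
    (run f g γ agent reps x0 (lastUpdate agent k j)).loc j =
      (run f g γ agent reps x0 k).loc j := by
  induction k with
  | zero => rfl
  | succ k ih =>
    by_cases h : j = agent (k + 1)
    · subst h; rw [lastUpdate_succ_self]
    · rw [lastUpdate_succ_of_ne h, ih, run_succ_loc_of_ne x0 h]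

theorem sum_weight_smul_update (y : Fin M → EuclideanSpace ℝ (Fin n)) (i : Fin M)
    (u : EuclideanSpace ℝ (Fin n)) :
    ∑ j, weight γ j • Function.update y i u j =
      ∑ j, weight γ j • y j + weight γ i • (u - y i) := by
  rw [← sub_eq_iff_eq_add', ← Finset.sum_sub_distrib, Finset.sum_eq_single i]
  · simp [smul_sub]
  · intro j _ hj
    simp [hj]
  · simp

/-- The adjustment `Δ` telescopes to `πᵢ (u - yᵢ)`, and adding it to the mean of `y` gives the mean
of `y` with coordinate `i` replaced by `u`. -/
theorem localStep_iterate (i : Fin M) (y : Fin M → EuclideanSpace ℝ (Fin n)) (p : ℕ) :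
    (localStep f g γ i (∑ j, weight γ j • y j))^[p] (0, y i) =
      (weight γ i • ((fun u => stepMap f g γ i (Function.update y i u))^[p] (y i) - y i),
        (fun u => stepMap f g γ i (Function.update y i u))^[p] (y i)) := by
  induction p with
  | zero => simp
  | succ p ih =>
    rw [Function.iterate_succ_apply', ih, Function.iterate_succ_apply']
    set u := (fun u => stepMap f g γ i (Function.update y i u))^[p] (y i)
    have h : stepMap f g γ i (Function.update y i u) =
        prox (masterStep γ) g (∑ j, weight γ j • y j + weight γ i • (u - y i)) -
          γ i • gradient (f i)
            (prox (masterStep γ) g (∑ j, weight γ j • y j + weight γ i • (u - y i))) := by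
      rw [stepMap, sum_weight_smul_update]
    rw [h]
    refine Prod.ext ?_ rfl
    simp only [localStep]
    rw [← smul_add]
    congr 1
    abel

/-- The induction covers all earlier times because the received master dates from a past update and
must be rewritten as a weighted mean at that time. -/
theorem run_master_and_succ_loc (hw : ∑ i, weight γ i = 1) (k : ℕ) :
    (∀ l ≤ k, (run f g γ agent reps x0 l).master =
      ∑ j, weight γ j • (run f g γ agent reps x0 l).loc j) ∧
    (∀ l < k, (run f g γ agent reps x0 (l + 1)).loc (agent (l + 1)) =
      (fun u => stepMap f g γ (agent (l + 1)) (Function.update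
        ((run f g γ agent reps x0 (lastUpdate agent l (agent (l + 1)))).loc)
          (agent (l + 1)) u))^[reps (l + 1)]
      ((run f g γ agent reps x0 l).loc (agent (l + 1)))) := by
  induction k with
  | zero =>
    refine ⟨fun l hl => ?_, fun l hl => absurd hl (Nat.not_lt_zero l)⟩
    obtain rfl := Nat.le_zero.1 hl
    simp [run, ← Finset.sum_smul, hw]
  | succ k ih =>
    have h1 := run_received (f := f) (g := g) (γ := γ) (agent := agent) (reps := reps) x0 k
      (agent (k + 1))
    rw [ih.1 _ (lastUpdate_le k _)] at h1
    have h2 := run_loc_lastUpdate (f := f) (g := g) (γ := γ) (agent := agent) (reps := reps) x0 k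
      (agent (k + 1))
    have h3 := localStep_iterate (f := f) (g := g) (γ := γ) (agent (k + 1))
      (run f g γ agent reps x0 (lastUpdate agent k (agent (k + 1)))).loc (reps (k + 1))
    rw [← h1, h2] at h3
    refine ⟨fun l hl => ?_, fun l hl => ?_⟩
    · rcases Nat.lt_or_eq_of_le hl with hl | rfl
      · exact ih.1 l (Nat.lt_succ_iff.1 hl)
      · simp only [run, exchange]
        rw [sum_weight_smul_update, h3, ih.1 k le_rfl]
    · rcases Nat.lt_or_eq_of_le (Nat.lt_succ_iff.1 hl) with hl | rfl
      · exact ih.2 l hl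
      · simp only [run, exchange, Function.update_self]
        rw [h3]

theorem isAsyncRun_run (hw : ∑ i, weight γ i = 1) :
    IsAsyncRun f g γ agent reps (fun k => (run f g γ agent reps x0 k).loc) where
  succ_of_ne _ _ h := run_succ_loc_of_ne x0 h
  succ_self k := (run_master_and_succ_loc x0 hw (k + 1)).2 k (Nat.lt_succ_self k)

theorem run_master (hw : ∑ i, weight γ i = 1) (k : ℕ) :
    (run f g γ agent reps x0 k).master = ∑ j, weight γ j • (run f g γ agent reps x0 k).loc j :=
  (run_master_and_succ_loc x0 hw k).1 k le_rfl

end Run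

/-! ### Monotone envelope and almost invariant translations. -/

section Convergence

variable {n M : ℕ} {f : Fin M → EuclideanSpace ℝ (Fin n) → ℝ}
  {g : EuclideanSpace ℝ (Fin n) → EReal} {L γ : Fin M → ℝ} {agent : ℕ → Fin M} {reps : ℕ → ℕ}
  {X : ℕ → Fin M → EuclideanSpace ℝ (Fin n)} {x : EuclideanSpace ℝ (Fin n)}

/-- The largest distance to the local points of `x`, over all workers and all snapshots of the
local parameters that are still in use at time `k`. -/
noncomputable def envelope (f : Fin M → EuclideanSpace ℝ (Fin n) → ℝ) (γ : Fin M → ℝ) (agent : ℕ → Fin M)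
    (X : ℕ → Fin M → EuclideanSpace ℝ (Fin n)) (x : EuclideanSpace ℝ (Fin n)) (k : ℕ) : ℝ :=
  ‖fun i j => X (lastUpdate agent k i) j - localPoint f γ x j‖

theorem envelope_nonneg (k : ℕ) : 0 ≤ envelope f γ agent X x k := norm_nonneg _

theorem norm_snapshot_sub_le_envelope (k : ℕ) (i j : Fin M) :
    ‖X (lastUpdate agent k i) j - localPoint f γ x j‖ ≤ envelope f γ agent X x k :=
  (norm_le_pi_norm (fun j => X (lastUpdate agent k i) j - localPoint f γ x j) j).trans
    (norm_le_pi_norm (fun i j => X (lastUpdate agent k i) j - localPoint f γ x j) i)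

theorem envelope_le {k : ℕ} {r : ℝ} (hr : 0 ≤ r)
    (h : ∀ i j, ‖X (lastUpdate agent k i) j - localPoint f γ x j‖ ≤ r) :
    envelope f γ agent X x k ≤ r :=
  (pi_norm_le_iff_of_nonneg hr).2 fun i => (pi_norm_le_iff_of_nonneg hr).2 fun j => h i j

theorem exists_le_of_le_envelope {k : ℕ} {C : ℝ} (hC : 0 < C)
    (h : C ≤ envelope f γ agent X x k) :
    ∃ i j, C ≤ ‖X (lastUpdate agent k i) j - localPoint f γ x j‖ := by
  by_contra! hcon
  refine not_lt.2 h ?_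
  exact (pi_norm_lt_iff hC).2 fun i => (pi_norm_lt_iff hC).2 fun j => hcon i j

theorem norm_update_sub_le {y : Fin M → EuclideanSpace ℝ (Fin n)} {r : ℝ} {i : Fin M}
    {u : EuclideanSpace ℝ (Fin n)} (hy : ∀ j, ‖y j - localPoint f γ x j‖ ≤ r)
    (hu : ‖u - localPoint f γ x i‖ ≤ r) (j : Fin M) :
    ‖Function.update y i u j - localPoint f γ x j‖ ≤ r := by
  by_cases h : j = i
  · subst h; simpa using hu
  · simpa [h] using hy j

namespace Assumptions

theorem norm_iterate_stepMap_sub_le (h : Assumptions f g L γ) (hx : IsMinimizer f g x)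
    {y : Fin M → EuclideanSpace ℝ (Fin n)} {r : ℝ} (hy : ∀ j, ‖y j - localPoint f γ x j‖ ≤ r)
    (i : Fin M) (p : ℕ) :
    ‖(fun u => stepMap f g γ i (Function.update y i u))^[p] (y i) - localPoint f γ x i‖ ≤ r := by
  induction p with
  | zero => exact hy i
  | succ p ih =>
    rw [Function.iterate_succ_apply']
    exact h.norm_stepMap_sub_le hx i (norm_update_sub_le hy ih)

/-- The only new snapshot consists of current coordinates, already on the diagonal of the old
snapshots, and of one fresh coordinate, bounded by nonexpansiveness. -/
theorem envelope_succ_le (h : Assumptions f g L γ) (hX : IsAsyncRun f g γ agent reps X)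
    (hx : IsMinimizer f g x) (k : ℕ) :
    envelope f γ agent X x (k + 1) ≤ envelope f γ agent X x k := by
  refine envelope_le (envelope_nonneg k) fun i j => ?_
  by_cases hi : i = agent (k + 1)
  · subst hi
    rw [lastUpdate_succ_self]
    by_cases hj : j = agent (k + 1)
    · subst hj
      rw [hX.succ_self, ← hX.apply_lastUpdate k]
      exact h.norm_iterate_stepMap_sub_le hx (norm_snapshot_sub_le_envelope k _) _ _
    · rw [hX.succ_of_ne k j hj, ← hX.apply_lastUpdate k j]
      exact norm_snapshot_sub_le_envelope k j j
  · rw [lastUpdate_succ_of_ne hi]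
    exact norm_snapshot_sub_le_envelope k i j

theorem tendsto_envelope (h : Assumptions f g L γ) (hX : IsAsyncRun f g γ agent reps X)
    (hx : IsMinimizer f g x) :
    ∃ C, 0 ≤ C ∧ (∀ k, C ≤ envelope f γ agent X x k) ∧
      Tendsto (envelope f γ agent X x) atTop (𝓝 C) := by
  have hbdd : BddBelow (range (envelope f γ agent X x)) :=
    ⟨0, forall_mem_range.2 fun k => envelope_nonneg k⟩
  exact ⟨_, le_ciInf fun k => envelope_nonneg k, fun k => ciInf_le hbdd k,
    tendsto_atTop_ciInf (antitone_nat_of_succ_le (h.envelope_succ_le hX hx)) hbdd⟩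

/-- Every updated local parameter comes from one local step from parameters within the envelope. -/
theorem exists_eq_stepMap (h : Assumptions f g L γ) (hX : IsAsyncRun f g γ agent reps X)
    (hreps : ∀ k, 1 ≤ k → 1 ≤ reps k) (hx : IsMinimizer f g x) (k : ℕ) :
    ∃ y, X (k + 1) (agent (k + 1)) = stepMap f g γ (agent (k + 1)) y ∧
      (∀ l, l ≠ agent (k + 1) → y l = X (lastUpdate agent k (agent (k + 1))) l) ∧
      ∀ j, ‖y j - localPoint f γ x j‖ ≤ envelope f γ agent X x k := by
  -- Only the last repetition is split off; its argument differs from the snapshot at most in the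
  -- worker's own coordinate.
  obtain ⟨p, hp⟩ := Nat.exists_eq_succ_of_ne_zero
    (Nat.one_le_iff_ne_zero.1 (hreps (k + 1) (Nat.succ_pos k)))
  have h1 := hX.succ_self k
  rw [hp, Function.iterate_succ_apply', ← hX.apply_lastUpdate k] at h1
  refine ⟨_, h1, fun l hl => by simp [hl], ?_⟩
  exact norm_update_sub_le (norm_snapshot_sub_le_envelope k _)
    (h.norm_iterate_stepMap_sub_le hx (norm_snapshot_sub_le_envelope k _) _ p)

/-- Translating `x` by `v` almost leaves the gradient of `f i` and the proximal fixed point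
equation invariant. -/
def AlmostInvariant (f : Fin M → EuclideanSpace ℝ (Fin n) → ℝ)
    (g : EuclideanSpace ℝ (Fin n) → EReal) (L γ : Fin M → ℝ) (x v : EuclideanSpace ℝ (Fin n))
    (ε : ℝ) (i : Fin M) : Prop :=
  ‖gradient (f i) (x + v) - gradient (f i) x‖ ≤ (1 + L i) * ε ∧
    ‖prox (masterStep γ) g (∑ j, weight γ j • localPoint f γ x j + v) - (x + v)‖ ≤ 2 * ε

/-- The proximal point of the mean of `y` is within `ε` of `x + v`; Lipschitz continuity of the
gradient and of the prox transfers the estimates to the exact translate. -/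
theorem almostInvariant_of_close (h : Assumptions f g L γ) {ε : ℝ}
    {y : Fin M → EuclideanSpace ℝ (Fin n)} {v : EuclideanSpace ℝ (Fin n)} {i : Fin M}
    (hy : ∀ j, ‖y j - localPoint f γ x j - v‖ ≤ ε)
    (hz : ‖prox (masterStep γ) g (∑ j, weight γ j • y j) - x - v‖ ≤ ε)
    (hG : ‖gradient (f i) (prox (masterStep γ) g (∑ j, weight γ j • y j)) -
        gradient (f i) x‖ ≤ ε) :
    AlmostInvariant f g L γ x v ε i := by
  set z := prox (masterStep γ) g (∑ j, weight γ j • y j) with hzdef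
  have hz' : ‖(x + v) - z‖ ≤ ε := by rwa [norm_sub_rev, ← sub_sub]
  constructor
  · have h1 := (h.smooth i).2 (x + v) z
    have h2 := norm_sub_le_norm_sub_add_norm_sub (gradient (f i) (x + v)) (gradient (f i) z)
      (gradient (f i) x)
    have h3 := mul_le_mul_of_nonneg_left hz' (h.L_pos i).le
    linarith
  · have h1 := h.prox_le (∑ j, weight γ j • localPoint f γ x j + v) (∑ j, weight γ j • y j)
    have h2 : ‖∑ j, weight γ j • localPoint f γ x j + v - ∑ j, weight γ j • y j‖ ≤ ε := by
      have h3 : ∑ j, weight γ j • localPoint f γ x j + v - ∑ j, weight γ j • y j =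
          -∑ j, weight γ j • (y j - localPoint f γ x j - v) := by
        simp only [smul_sub, Finset.sum_sub_distrib, ← Finset.sum_smul, h.sum_weight, one_smul]
        abel
      rw [h3, norm_neg]
      calc ‖∑ j, weight γ j • (y j - localPoint f γ x j - v)‖
          ≤ ∑ j, weight γ j * ε := by
            refine norm_sum_le_of_le _ fun j _ => ?_
            rw [norm_smul, Real.norm_of_nonneg (h.weight_pos j).le]
            exact mul_le_mul_of_nonneg_left (hy j) (h.weight_pos j).le
        _ = ε := by rw [← Finset.sum_mul, h.sum_weight, one_mul]
    rw [← hzdef] at h1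
    have h4 := norm_sub_le_norm_sub_add_norm_sub
      (prox (masterStep γ) g (∑ j, weight γ j • localPoint f γ x j + v)) z (x + v)
    rw [norm_sub_rev z] at h4
    linarith

/-- If the envelope does not tend to zero, then some late update is at a translation from the local
point of `x` under which `x` is almost invariant. -/
theorem exists_almostInvariant (h : Assumptions f g L γ) (hX : IsAsyncRun f g γ agent reps X)
    (hagent : ∀ i, ∀ N : ℕ, ∃ k, N ≤ k ∧ agent k = i)
    (hreps : ∀ k, 1 ≤ k → 1 ≤ reps k) (hx : IsMinimizer f g x) {C : ℝ} (hC : 0 < C)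
    (hCle : ∀ k, C ≤ envelope f γ agent X x k)
    (hlim : Tendsto (envelope f γ agent X x) atTop (𝓝 C)) {ε : ℝ} (hε : 0 < ε) (T : ℕ) :
    ∃ k v, v = X (k + 1) (agent (k + 1)) - localPoint f γ x (agent (k + 1)) ∧
      T ≤ lastUpdate agent k (agent (k + 1)) ∧ T ≤ k ∧ C ≤ ‖v‖ ∧ ‖v‖ ≤ C + ε ∧
      ∀ i, AlmostInvariant f g L γ x v ε i := by
  -- Tolerances are chosen backwards: `δ₁` serves the update found first, whose inputs must be
  -- within `δ₂` for rigidity at the updates that produced them.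
  obtain ⟨δ₂, hδ₂, hrig₂⟩ := h.rigidity hx hC hε
  obtain ⟨δ₁, hδ₁, hrig₁⟩ := h.rigidity hx hC (lt_min hδ₂ hε)
  have hδ : 0 < min (min δ₁ δ₂) ε := lt_min (lt_min hδ₁ hδ₂) hε
  obtain ⟨T₁, hT₁⟩ := eventually_atTop.1 (hlim.eventually_le_const
    (lt_add_of_pos_right C hδ))
  -- Four thresholds for four links: a snapshot in use at `K₄`, the update `k + 1` recorded in it,
  -- the snapshot used by that update, and the updates `m + 1` recorded there. The `+ 1` keeps the
  -- predecessors `k` and `m` late.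
  obtain ⟨K₁, hK₁⟩ := exists_forall_le_lastUpdate hagent (T₁ + 1)
  obtain ⟨K₂, hK₂⟩ := exists_forall_le_lastUpdate hagent (max K₁ T)
  obtain ⟨K₃, hK₃⟩ := exists_forall_le_lastUpdate hagent (max (max K₂ T) T₁ + 1)
  obtain ⟨K₄, hK₄⟩ := exists_forall_le_lastUpdate hagent K₃
  obtain ⟨i, j, hij⟩ := exists_le_of_le_envelope hC (hCle K₄)
  have hu := hK₃ _ (hK₄ K₄ le_rfl i) j
  obtain ⟨k, hk⟩ : ∃ k, lastUpdate agent (lastUpdate agent K₄ i) j = k + 1 :=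
    Nat.exists_eq_succ_of_ne_zero (by omega)
  have hj : agent (k + 1) = j := by
    rw [← hk]; exact agent_lastUpdate (by omega)
  rw [← hX.apply_lastUpdate (lastUpdate agent K₄ i) j, hk] at hij
  have hkk : max (max K₂ T) T₁ ≤ k := by omega
  have hd := hK₂ k (by omega) j
  have hd1 := hK₁ (lastUpdate agent k j) (by omega)
  set v := X (k + 1) j - localPoint f γ x j with hv
  have hδ₁' : min (min δ₁ δ₂) ε ≤ δ₁ := (min_le_left _ _).trans (min_le_left _ _)
  have hδ₂' : min (min δ₁ δ₂) ε ≤ δ₂ := (min_le_left _ _).trans (min_le_right _ _)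
  have hδε : min (min δ₁ δ₂) ε ≤ ε := min_le_right _ _
  obtain ⟨y, hy, hyl, hyb⟩ := h.exists_eq_stepMap hX hreps hx k
  rw [hj] at hy hyl
  have henv := hT₁ k (by omega)
  have hclose := hrig₁ j y v (fun l => (hyb l).trans (henv.trans (by linarith))) hij (by
    rw [← hy, hv, sub_self, norm_zero]; exact hδ₁.le)
  refine ⟨k, v, by rw [hj], by rw [hj]; omega, by omega, hij, ?_, fun l => ?_⟩
  · have := h.norm_stepMap_sub_le hx j hyb
    rw [← hy] at this
    linarith
  · by_cases hl : l = j
    · subst hl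
      exact h.almostInvariant_of_close (fun l => (hclose.1 l).trans (min_le_right _ _))
        (hclose.2.1.trans (min_le_right _ _)) (hclose.2.2.trans (min_le_right _ _))
    -- Second generation: the input of another worker `l` is an update of `l` within `δ₂` of `v`, so
    -- rigidity applies to it with the same `v`.
    · obtain ⟨m, hm⟩ : ∃ m, lastUpdate agent (lastUpdate agent k j) l = m + 1 :=
        Nat.exists_eq_succ_of_ne_zero (by have := hd1 l; omega)
      have hml : agent (m + 1) = l := by
        rw [← hm]; exact agent_lastUpdate (by omega)
      have hc := hclose.1 l
      rw [hyl l hl, ← hX.apply_lastUpdate (lastUpdate agent k j) l, hm] at hc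
      obtain ⟨y', hy', -, hyb'⟩ := h.exists_eq_stepMap hX hreps hx m
      rw [hml] at hy'
      have henv' := hT₁ m (by have := hd1 l; omega)
      have hclose' := hrig₂ l y' v (fun l => (hyb' l).trans (henv'.trans (by linarith))) hij (by
        rw [← hy']; exact hc.trans (min_le_left _ _))
      exact h.almostInvariant_of_close hclose'.1 hclose'.2.1 hclose'.2.2

/-- Passage to the limit in `AlmostInvariant`. -/
theorem exists_isMinimizer_add (h : Assumptions f g L γ) {C : ℝ}
    {R : EuclideanSpace ℝ (Fin n) → ℝ → Prop}
    (hR : ∀ ε, 0 < ε → ∃ v, C ≤ ‖v‖ ∧ ‖v‖ ≤ C + ε ∧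
      (∀ i, AlmostInvariant f g L γ x v ε i) ∧ R v ε) :
    ∃ v, C ≤ ‖v‖ ∧ IsMinimizer f g (x + v) ∧
      (∀ i, localPoint f γ (x + v) i = localPoint f γ x i + v) ∧
      ∀ ε, 0 < ε → ∃ v' ε', ‖v' - v‖ ≤ ε ∧ ε' ≤ ε ∧ R v' ε' := by
  choose v hv using fun m : ℕ => hR (1 / ((m : ℝ) + 1)) Nat.one_div_pos_of_nat
  have hmem : ∀ m, v m ∈ Metric.closedBall (0 : EuclideanSpace ℝ (Fin n)) (C + 1) := by
    intro m
    rw [mem_closedBall_zero_iff]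
    refine (hv m).2.1.trans ((add_le_add_iff_left C).2 ?_)
    rw [div_le_one (by positivity)]
    linarith [(Nat.cast_nonneg m : (0 : ℝ) ≤ m)]
  obtain ⟨w, -, φ, hφ, hw⟩ := (isCompact_closedBall _ _).tendsto_subseq hmem
  have hε : Tendsto (fun m => 1 / ((φ m : ℝ) + 1)) atTop (𝓝 0) :=
    tendsto_one_div_add_atTop_nhds_zero_nat.comp hφ.tendsto_atTop
  have hlip : ∀ i, Continuous (gradient (f i)) := fun i =>
    (LipschitzWith.of_dist_le_mul (K := (L i).toNNReal) fun a b => by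
      simpa [dist_eq_norm, Real.coe_toNNReal _ (h.L_pos i).le] using (h.smooth i).2 a b).continuous
  have hprox : Continuous (prox (masterStep γ) g) :=
    (LipschitzWith.of_dist_le_mul (K := 1) fun a b => by
      simpa [dist_eq_norm] using h.prox_le a b).continuous
  have hzero : ∀ (F : EuclideanSpace ℝ (Fin n) → EuclideanSpace ℝ (Fin n)) (c : ℝ),
      Continuous F → (∀ m, ‖F (v (φ m))‖ ≤ c * (1 / ((φ m : ℝ) + 1))) → F w = 0 := by
    intro F c hF hle
    have h1 : Tendsto (fun m => F (v (φ m))) atTop (𝓝 (F w)) := (hF.tendsto w).comp hw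
    have h2 : Tendsto (fun m => F (v (φ m))) atTop (𝓝 0) :=
      squeeze_zero_norm hle (by simpa using hε.const_mul c)
    exact tendsto_nhds_unique h1 h2
  have hgrad : ∀ i, gradient (f i) (x + w) = gradient (f i) x := by
    intro i
    refine sub_eq_zero.1 (hzero (fun u => gradient (f i) (x + u) - gradient (f i) x) (1 + L i)
      ?_ fun m => ((hv (φ m)).2.2.1 i).1)
    exact ((hlip i).comp (continuous_const.add continuous_id)).sub continuous_const
  have hpx : prox (masterStep γ) g (∑ i, weight γ i • localPoint f γ x i + w) = x + w := by
    refine sub_eq_zero.1 (hzero (fun u => prox (masterStep γ) g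
      (∑ i, weight γ i • localPoint f γ x i + u) - (x + u)) 2
      ?_ fun m => ((hv (φ m)).2.2.1 ⟨0, h.M_pos⟩).2)
    exact (hprox.comp (continuous_const.add continuous_id)).sub
      (continuous_const.add continuous_id)
  refine ⟨w, ?_, (h.isMinimizer_add hgrad hpx).1, (h.isMinimizer_add hgrad hpx).2, ?_⟩
  · exact ge_of_tendsto' hw.norm fun m => (hv (φ m)).1
  · intro ε hεpos
    have h1 : ∀ᶠ m in atTop, ‖v (φ m) - w‖ < ε := by
      have := hw.eventually (Metric.ball_mem_nhds w hεpos)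
      filter_upwards [this] with m hm
      rwa [dist_eq_norm] at hm
    obtain ⟨m, hm1, hm2⟩ := (h1.and (hε.eventually (gt_mem_nhds hεpos))).exists
    exact ⟨_, _, hm1.le, hm2.le, (hv (φ m)).2.2.2⟩

/-! ### Backward propagation of rigidity under bounded delays and repetitions. -/

/-- Rigidity along boundedly many repetitions of a worker. -/
theorem rigidity_iterate (h : Assumptions f g L γ) (hx : IsMinimizer f g x) {C : ℝ} (hC : 0 < C)
    (N : ℕ) : ∀ {ε : ℝ}, 0 < ε →
    ∃ δ, 0 < δ ∧ ∀ (i : Fin M) (y : Fin M → EuclideanSpace ℝ (Fin n))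
      (v : EuclideanSpace ℝ (Fin n)), (∀ j, ‖y j - localPoint f γ x j‖ ≤ C + δ) → C ≤ ‖v‖ →
      ∀ p ≤ N, ‖(fun u => stepMap f g γ i (Function.update y i u))^[p] (y i) -
        localPoint f γ x i - v‖ ≤ δ →
      ‖y i - localPoint f γ x i - v‖ ≤ ε := by
  induction N with
  | zero =>
    intro ε hε
    refine ⟨ε, hε, fun i y v _ _ p hp hle => ?_⟩
    obtain rfl := Nat.le_zero.1 hp
    exact hle
  | succ N ih =>
    intro ε hε
    obtain ⟨δ₁, hδ₁, h₁⟩ := ih hε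
    obtain ⟨δ₂, hδ₂, h₂⟩ := h.rigidity hx hC hδ₁
    have hm₁ := min_le_left δ₁ δ₂
    have hm₂ := min_le_right δ₁ δ₂
    refine ⟨min δ₁ δ₂, lt_min hδ₁ hδ₂, fun i y v hy hv p hp hle => ?_⟩
    have hy₁ : ∀ j, ‖y j - localPoint f γ x j‖ ≤ C + δ₁ := fun j => (hy j).trans (by linarith)
    have hy₂ : ∀ j, ‖y j - localPoint f γ x j‖ ≤ C + δ₂ := fun j => (hy j).trans (by linarith)
    rcases Nat.lt_or_eq_of_le hp with hp | rfl
    · exact h₁ i y v hy₁ hv p (Nat.lt_succ_iff.1 hp) (hle.trans hm₁)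
    · rw [Function.iterate_succ_apply'] at hle
      have h3 := h₂ i _ v (norm_update_sub_le hy₂ (h.norm_iterate_stepMap_sub_le hx hy₂ i N)) hv
        (hle.trans hm₂)
      have h4 := h3.1 i
      rw [Function.update_self] at h4
      exact h₁ i y v hy₁ hv N le_rfl h4

/-- Rigidity along one exchange with boundedly many repetitions. -/
theorem rigidity_exchange (h : Assumptions f g L γ) (hX : IsAsyncRun f g γ agent reps X)
    (hreps : ∀ k, 1 ≤ k → 1 ≤ reps k) {P : ℕ} (hP : ∀ k, 1 ≤ k → reps k ≤ P)
    (hx : IsMinimizer f g x) {C : ℝ} (hC : 0 < C) {ε : ℝ} (hε : 0 < ε) :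
    ∃ δ, 0 < δ ∧ ∀ (k : ℕ) (v : EuclideanSpace ℝ (Fin n)),
      envelope f γ agent X x k ≤ C + δ → C ≤ ‖v‖ →
      ‖X (k + 1) (agent (k + 1)) - localPoint f γ x (agent (k + 1)) - v‖ ≤ δ →
      ∀ l, ‖X (lastUpdate agent k (agent (k + 1))) l - localPoint f γ x l - v‖ ≤ ε := by
  obtain ⟨δ₁, hδ₁, h₁⟩ := h.rigidity_iterate hx hC P hε
  obtain ⟨δ₂, hδ₂, h₂⟩ := h.rigidity hx hC hε
  have hm₁ := min_le_left δ₁ δ₂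
  have hm₂ := min_le_right δ₁ δ₂
  refine ⟨min δ₁ δ₂, lt_min hδ₁ hδ₂, fun k v henv hv hle l => ?_⟩
  -- The worker's own coordinate must be traced back through all repetitions; the others enter the
  -- last one unchanged.
  by_cases hl : l = agent (k + 1)
  · subst hl
    rw [hX.succ_self, ← hX.apply_lastUpdate k] at hle
    exact h₁ _ _ v (fun j => (norm_snapshot_sub_le_envelope k _ j).trans (by linarith)) hv _
      (hP (k + 1) (Nat.succ_pos k)) (hle.trans hm₁)
  · obtain ⟨y, hy, hyl, hyb⟩ := h.exists_eq_stepMap hX hreps hx k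
    rw [hy] at hle
    have h3 := h₂ _ y v (fun j => (hyb j).trans (by linarith)) hv (hle.trans hm₂)
    rw [← hyl l hl]
    exact h3.1 l

/-- Rigidity along a time window of bounded length. -/
theorem rigidity_window (h : Assumptions f g L γ) (hX : IsAsyncRun f g γ agent reps X)
    (hreps : ∀ k, 1 ≤ k → 1 ≤ reps k) {P : ℕ} (hP : ∀ k, 1 ≤ k → reps k ≤ P)
    (hx : IsMinimizer f g x) {C : ℝ} (hC : 0 < C) (N : ℕ) : ∀ {ε : ℝ}, 0 < ε →
    ∃ δ, 0 < δ ∧ ∀ (d : ℕ) (j : Fin M) (v : EuclideanSpace ℝ (Fin n)),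
      (∀ s, d ≤ s + N → envelope f γ agent X x s ≤ C + δ) → C ≤ ‖v‖ →
      ‖X d j - localPoint f γ x j - v‖ ≤ δ →
      ∀ s ≤ d, d ≤ s + N → ‖X s j - localPoint f γ x j - v‖ ≤ ε := by
  induction N with
  | zero =>
    intro ε hε
    refine ⟨ε, hε, fun d j v _ _ hle s hs hs' => ?_⟩
    obtain rfl : s = d := le_antisymm hs hs'
    exact hle
  | succ N ih =>
    intro ε hε
    obtain ⟨δ₁, hδ₁, h₁⟩ := h.rigidity_exchange hX hreps hP hx hC hε
    obtain ⟨δ₂, hδ₂, h₂⟩ := ih (lt_min hδ₁ hε)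
    have hm₁ := min_le_left δ₁ δ₂
    have hm₂ := min_le_right δ₁ δ₂
    refine ⟨min δ₁ δ₂, lt_min hδ₁ hδ₂, fun d j v henv hv hle s hs hs' => ?_⟩
    have hwin := h₂ d j v (fun s hs => (henv s (by omega)).trans (by linarith)) hv (hle.trans hm₂)
    rcases Nat.lt_or_eq_of_le hs' with hs' | hs'
    · exact (hwin s hs (by omega)).trans (min_le_right _ _)
    · have h3 := hwin (s + 1) (by omega) (by omega)
      -- Undo time `s + 1`: if `j` was active, its snapshot agrees with `X s` in coordinate `j`;
      -- otherwise nothing moved.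
      by_cases hj : j = agent (s + 1)
      · subst hj
        have h4 := h₁ s v ((henv s (by omega)).trans (by linarith)) hv
          (h3.trans (min_le_left _ _)) (agent (s + 1))
        rwa [hX.apply_lastUpdate] at h4
      · rw [hX.succ_of_ne s j hj] at h3
        exact h3.trans (min_le_right _ _)

/-- With bounded delays and bounded numbers of repetitions, all snapshots in use at some time are
close to one common translate. -/
theorem exists_almostInvariant_snapshots (h : Assumptions f g L γ)
    (hX : IsAsyncRun f g γ agent reps X)
    (hagent : ∀ i, ∀ N : ℕ, ∃ k, N ≤ k ∧ agent k = i)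
    (hreps : ∀ k, 1 ≤ k → 1 ≤ reps k) {P : ℕ} (hP : ∀ k, 1 ≤ k → reps k ≤ P) {N : ℕ}
    (hN : ∀ d i, d ≤ lastUpdate agent d i + N)
    (hx : IsMinimizer f g x) {C : ℝ} (hC : 0 < C)
    (hCle : ∀ k, C ≤ envelope f γ agent X x k)
    (hlim : Tendsto (envelope f γ agent X x) atTop (𝓝 C)) {ε : ℝ} (hε : 0 < ε) :
    ∃ v, C ≤ ‖v‖ ∧ ‖v‖ ≤ C + ε ∧ (∀ i, AlmostInvariant f g L γ x v ε i) ∧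
      ∃ d, ∀ i j, ‖X (lastUpdate agent d i) j - localPoint f γ x j - v‖ ≤ ε := by
  obtain ⟨δ₂, hδ₂, h₂⟩ := h.rigidity_window hX hreps hP hx hC N hε
  obtain ⟨δ₁, hδ₁, h₁⟩ := h.rigidity_exchange hX hreps hP hx hC hδ₂
  obtain ⟨T, hT⟩ := eventually_atTop.1 (hlim.eventually_le_const
    (lt_add_of_pos_right C (lt_min hδ₁ hδ₂)))
  have hm₁ := min_le_left δ₁ δ₂
  have hm₂ := min_le_right δ₁ δ₂
  -- `T + N` keeps the window of length `N` before the snapshot of exchange `k + 1` beyond `T`; the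
  -- time of that snapshot is the witness.
  obtain ⟨k, v, hv, hTd, hTk, hCv, hvC, hinv⟩ :=
    h.exists_almostInvariant hX hagent hreps hx hC hCle hlim hε (T + N)
  refine ⟨v, hCv, hvC, hinv, lastUpdate agent k (agent (k + 1)), fun i j => ?_⟩
  have h3 := h₁ k v ((hT k (by omega)).trans (by linarith)) hCv
    (by rw [← hv, sub_self, norm_zero]; exact hδ₁.le)
  exact h₂ _ j v (fun s hs => (hT s (by omega)).trans (by linarith)) hCv (h3 j) _
    (lastUpdate_le _ i) (hN _ i)

/-! ### Vanishing of the envelope and convergence of the iterates. -/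

theorem tendsto_envelope_zero_of_unique (h : Assumptions f g L γ)
    (hX : IsAsyncRun f g γ agent reps X)
    (hagent : ∀ i, ∀ N : ℕ, ∃ k, N ≤ k ∧ agent k = i)
    (hreps : ∀ k, 1 ≤ k → 1 ≤ reps k) (hx : IsMinimizer f g x)
    (huniq : ∀ y, IsMinimizer f g y → y = x) :
    Tendsto (envelope f γ agent X x) atTop (𝓝 0) := by
  obtain ⟨C, hC0, hCle, hlim⟩ := h.tendsto_envelope hX hx
  rcases hC0.eq_or_lt with rfl | hC
  · exact hlim
  obtain ⟨v, hv, hmin, -⟩ := h.exists_isMinimizer_add (x := x) (C := C) (R := fun _ _ => True)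
    fun ε hε => by
      obtain ⟨k, v, -, -, -, h1, h2, h3⟩ :=
        h.exists_almostInvariant hX hagent hreps hx hC hCle hlim hε 0
      exact ⟨v, h1, h2, h3, trivial⟩
  have hv0 : v = 0 := by simpa using huniq _ hmin
  rw [hv0, norm_zero] at hv
  exact absurd hv (not_le.2 hC)

theorem exists_tendsto_envelope_zero (h : Assumptions f g L γ)
    (hX : IsAsyncRun f g γ agent reps X)
    (hagent : ∀ i, ∀ N : ℕ, ∃ k, N ≤ k ∧ agent k = i)
    (hreps : ∀ k, 1 ≤ k → 1 ≤ reps k) {P : ℕ} (hP : ∀ k, 1 ≤ k → reps k ≤ P) {N : ℕ}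
    (hN : ∀ d i, d ≤ lastUpdate agent d i + N) (hx : IsMinimizer f g x) :
    ∃ y, IsMinimizer f g y ∧ Tendsto (envelope f γ agent X y) atTop (𝓝 0) := by
  obtain ⟨C, hC0, hCle, hlim⟩ := h.tendsto_envelope hX hx
  rcases hC0.eq_or_lt with rfl | hC
  · exact ⟨x, hx, hlim⟩
  obtain ⟨v, -, hmin, hloc, hclose⟩ := h.exists_isMinimizer_add (x := x) (C := C)
    (R := fun v ε => ∃ d, ∀ i j, ‖X (lastUpdate agent d i) j - localPoint f γ x j - v‖ ≤ ε)
    fun ε hε => h.exists_almostInvariant_snapshots hX hagent hreps hP hN hx hC hCle hlim hε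
  refine ⟨x + v, hmin, ?_⟩
  obtain ⟨C', hC0', hCle', hlim'⟩ := h.tendsto_envelope hX hmin
  -- The envelope of `x + v` stays above its limit `C'`, so one time with small envelope for each
  -- `ε` suffices.
  suffices hC' : C' ≤ 0 by rwa [le_antisymm hC' hC0'] at hlim'
  refine le_of_forall_pos_le_add fun ε hε => ?_
  obtain ⟨v', ε', hv', hε', d, hd⟩ := hclose (ε / 2) (half_pos hε)
  rw [zero_add]
  refine (hCle' d).trans (envelope_le hε.le fun i j => ?_)
  have h1 : X (lastUpdate agent d i) j - localPoint f γ (x + v) j =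
      (X (lastUpdate agent d i) j - localPoint f γ x j - v') + (v' - v) := by
    rw [hloc j]; abel
  rw [h1]
  have := norm_add_le (X (lastUpdate agent d i) j - localPoint f γ x j - v') (v' - v)
  linarith [hd i j]

/-- The iterates are controlled by the envelope. -/
theorem norm_iterate_sub_le_envelope (h : Assumptions f g L γ) (x0 : EuclideanSpace ℝ (Fin n))
    (hx : IsMinimizer f g x) (k : ℕ) :
    ‖iterate f g γ agent reps x0 k - x‖ ≤
      envelope f γ agent (fun k => (run f g γ agent reps x0 k).loc) x k := by
  have hX := isAsyncRun_run (f := f) (g := g) (agent := agent) (reps := reps) x0 h.sum_weight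
  set X := fun k => (run f g γ agent reps x0 k).loc with hXdef
  have h1 := h.prox_le (run f g γ agent reps x0 k).master (∑ i, weight γ i • localPoint f γ x i)
  rw [(h.isMinimizer_iff x).1 hx, run_master x0 h.sum_weight, ← sum_weight_smul_sub] at h1
  rw [iterate, run_master x0 h.sum_weight]
  refine h1.trans ?_
  calc ‖∑ j, weight γ j • (X k j - localPoint f γ x j)‖
      ≤ ∑ j, weight γ j * envelope f γ agent X x k := by
        refine norm_sum_le_of_le _ fun j _ => ?_
        rw [norm_smul, Real.norm_of_nonneg (h.weight_pos j).le, ← hX.apply_lastUpdate k j]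
        exact mul_le_mul_of_nonneg_left (norm_snapshot_sub_le_envelope k j j) (h.weight_pos j).le
    _ = envelope f γ agent X x k := by rw [← Finset.sum_mul, h.sum_weight, one_mul]

theorem tendsto_iterate (h : Assumptions f g L γ) (x0 : EuclideanSpace ℝ (Fin n))
    (hx : IsMinimizer f g x)
    (hlim : Tendsto (envelope f γ agent (fun k => (run f g γ agent reps x0 k).loc) x) atTop
      (𝓝 0)) :
    Tendsto (iterate f g γ agent reps x0) atTop (𝓝 x) :=
  tendsto_iff_norm_sub_tendsto_zero.2
    (squeeze_zero (fun _ => norm_nonneg _) (h.norm_iterate_sub_le_envelope x0 hx) hlim)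

end Assumptions

end Convergence

end DaveRPG

theorem theorem2 {n M : ℕ}
    (f : Fin M → EuclideanSpace ℝ (Fin n) → ℝ) (g : EuclideanSpace ℝ (Fin n) → EReal)
    (L γ : Fin M → ℝ)
    (hf_conv : ∀ i, ConvexOn ℝ Set.univ (f i))
    (hL : ∀ i, 0 < L i)
    (hf_smooth : ∀ i, DaveRPG.IsLSmooth (L i) (f i))
    (hg_proper : DaveRPG.IsProper g)
    (hg_conv : DaveRPG.IsConvex g)
    (hg_lsc : LowerSemicontinuous g)
    (hγ : ∀ i, γ i ∈ Set.Ioo 0 (2 / L i))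
    (agent : ℕ → Fin M) (reps : ℕ → ℕ)
    (h_agent : ∀ i, ∀ N : ℕ, ∃ k, N ≤ k ∧ agent k = i)
    (h_reps : ∀ k, 1 ≤ k → 1 ≤ reps k)
    (x0 : EuclideanSpace ℝ (Fin n)) :
    (∀ xstar, DaveRPG.IsMinimizer f g xstar →
      (∀ y, DaveRPG.IsMinimizer f g y → y = xstar) →
      Tendsto (DaveRPG.iterate f g γ agent reps x0) atTop (𝓝 xstar)) ∧
    ((∃ y, DaveRPG.IsMinimizer f g y) →
      (∃ B : ℕ, ∀ m, DaveRPG.epoch agent (m + 1) ≤ DaveRPG.epoch agent m + B) →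
      (∃ P : ℕ, ∀ k, 1 ≤ k → reps k ≤ P) →
      ∃ xstar, DaveRPG.IsMinimizer f g xstar ∧
        Tendsto (DaveRPG.iterate f g γ agent reps x0) atTop (𝓝 xstar)) := by
  have h : DaveRPG.Assumptions f g L γ :=
    ⟨hf_conv, hL, hf_smooth, hg_proper, hg_conv, hg_lsc, hγ,
      Nat.pos_of_ne_zero fun hM => by subst hM; exact (agent 0).elim0⟩
  have hX := DaveRPG.isAsyncRun_run (f := f) (g := g) (agent := agent) (reps := reps) x0
    h.sum_weight
  refine ⟨fun xstar hx huniq => ?_, ?_⟩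
  · exact h.tendsto_iterate x0 hx
      (h.tendsto_envelope_zero_of_unique hX h_agent h_reps hx huniq)
  · rintro ⟨y, hy⟩ ⟨B, hB⟩ ⟨P, hP⟩
    obtain ⟨xstar, hx, hlim⟩ := h.exists_tendsto_envelope_zero hX h_agent h_reps hP
      (DaveRPG.exists_le_lastUpdate_add h_agent hB) hy
    exact ⟨xstar, hx, h.tendsto_iterate x0 hx hlim⟩
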